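/- Let $p,q$ be odd primes with $q-p=2^m$, $m\ge 2$, and let $D=D_1\cdots D_n$ be a product of $n$ distinct odd primes, none equal to $p$ or $q$. Put $\widehat{D_i}=D/D_i$. Let $E=E_+$ be the elliptic curve $y^2=x(x+pD)(x+qD)$ over $\mathbb{Q}$, let $E':y^2=x^3-2(p+q)Dx^2+4^mD^2x$, and let $\varphi:E\to E'$, $\varphi(x,y)=\bigl(y^2/x^2,\;y(pqD^2-x^2)/x^2\bigr)$, be the 2-isogeny with kernel $E[\varphi]=\{O,(0,0)\}$. Let $$S^{(\varphi)}(E/\mathbb{Q})=\ker\Bigl(H^1(\mathbb{Q},E[\varphi])\to\prod_v H^1(\mathbb{Q}_v,E)\Bigr)$$ be the $\varphi$-Selmer group ($v$ runs over all places of $\mathbb{Q}$), viewed inside $\mathbb{Q}^*/\mathbb{Q}^{*2}$ through the Kummer isomorphism $\mathbb{Q}^*/\mathbb{Q}^{*2}\cong H^1(\mathbb{Q},E[\varphi])$, which sends $d$ to the class of the cocycle with value $O$ on $\sigma$ if $\sigma\sqrt d=\sqrt d$ and $(0,0)$ if $\sigma\sqrt d=-\sqrt d$. For $i=1,\dots,n$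 set $$\Pi_i^+(D)=\delta_i+\Bigl(1-\Bigl(\tfrac{q\widehat{D_i}}{D_i}\Bigr)\Bigr)\Bigl(1-\Bigl(\tfrac{p\widehat{D_i}}{D_i}\Bigr)\Bigr)+\sum_{l\mid pq\widehat{D_i}}\Bigl(1-\Bigl(\tfrac{D_i}{l}\Bigr)\Bigr),$$ where $l$ runs over primes, $(\cdot/\cdot)$ is the Legendre symbol, and $\delta_i=0$ if one of the following holds: (1) $D_i\equiv1\pmod 4$; (2) $m=2$ and $p-D\equiv2\pmod 8$; (3) $m\ge3$ and $p+D\equiv0\pmod 4$; and $\delta_i=1$ otherwise. Set $$\Pi_{n+1}^+(D)=\delta_{n+1}+\sum_{l\mid pqD}\Bigl(1-\Bigl(\tfrac{2}{l}\Bigr)\Bigr),$$ where $\delta_{n+1}=0$ if one of the following holds: (1) $m=3$ and $pD\equiv-1\pmod 8$; (2) $m=4$ and $pD\equiv1\pmod 8$; (3) $m\ge5$; and $\delta_{n+1}=1$ otherwise. Finally let $$\rho^+(D)=\sum_{i=1}^{n+1}\Bigl\lfloor\frac1{1+\Pi_i^+(D)}\Bigr\rfloor .$$ Then there is a subset $T\subset\{2,D_1,\dots,D_n\}$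 with $\#T=\rho^+(D)$ such that the subgroup $\langle T\rangle$ of $\mathbb{Q}^*/\mathbb{Q}^{*2}$ generated by the classes of the elements of $T$ satisfies $\langle T\rangle\subset S^{(\varphi)}(E/\mathbb{Q})$ and $\langle T\rangle\cong(\mathbb{Z}/2\mathbb{Z})^{\rho^+(D)}$. In particular $\dim_{2}S^{(\varphi)}(E/\mathbb{Q})\ge\rho^+(D)$, where $\dim_2$ is the dimension over $\mathbb{Z}/2\mathbb{Z}$. -/

import Mathlib

namespace TwoIsogenySelmer

noncomputable section

/-! ### The curves and the 2-isogeny -/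

/-- The curve `y² = x³ + a x² + b x` over a field `k`. -/
def curve {k : Type*} [Field k] (a b : k) : WeierstrassCurve.Affine k where
  a₁ := 0
  a₂ := a
  a₃ := 0
  a₄ := b
  a₆ := 0

/-- The set `E(L)` of `L`-rational points of `E : y² = x³ + a x² + b x`, for an extension `L` of
`k`. -/
abbrev Pts {k : Type*} [Field k] (a b : k) (L : Type*) [Field L] [Algebra k L] : Type _ :=
  ((curve a b).baseChange L).Point

section Isogeny

variable {k : Type*} [Field k] [CharZero k] (a b : k) {L : Type*} [Field L] [Algebra k L]

theorem nonsingular_iff (x y : L) :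
    ((curve a b).baseChange L).Nonsingular x y ↔
      y ^ 2 = x ^ 3 + algebraMap k L a * x ^ 2 + algebraMap k L b * x ∧
        (3 * x ^ 2 + 2 * algebraMap k L a * x + algebraMap k L b ≠ 0 ∨ y ≠ 0) := by
  have h2 : (2 : L) ≠ 0 := by
    have : CharZero L := charZero_of_injective_algebraMap (algebraMap k L).injective
    exact two_ne_zero
  rw [WeierstrassCurve.Affine.nonsingular_iff', WeierstrassCurve.Affine.equation_iff]
  simp [curve, WeierstrassCurve.Affine.baseChange, h2, -neg_add_rev]

/-- The image under the isogeny of an affine point with `x ≠ 0` is a nonsingular point of the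
isogenous curve. -/
theorem phi_nonsingular {x y : L} (h : ((curve a b).baseChange L).Nonsingular x y) (hx : x ≠ 0) :
    ((curve (-2 * a) (a ^ 2 - 4 * b)).baseChange L).Nonsingular
      (y ^ 2 / x ^ 2) (y * (algebraMap k L b - x ^ 2) / x ^ 2) := by
  have h2 : (2 : L) ≠ 0 := by
    have : CharZero L := charZero_of_injective_algebraMap (algebraMap k L).injective
    exact two_ne_zero
  rw [nonsingular_iff] at h ⊢
  obtain ⟨he, hn⟩ := h
  simp only [map_sub, map_mul, map_pow, map_neg, map_ofNat]
  set A := algebraMap k L a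
  set B := algebraMap k L b
  have hX : y ^ 2 / x ^ 2 = x + A + B / x := by
    rw [he]; field_simp
  refine ⟨?_, ?_⟩
  · have e1 : (y * (B - x ^ 2) / x ^ 2) ^ 2 = (y ^ 2 / x ^ 2) * (B / x - x) ^ 2 := by
      field_simp
    rw [e1, hX]
    field_simp
    ring
  · by_contra hcon
    push Not at hcon
    obtain ⟨h1, h3⟩ := hcon
    have h3' : y * (B - x ^ 2) = 0 := by
      rcases div_eq_zero_iff.mp h3 with h | h
      · exact h
      · exact absurd h (pow_ne_zero 2 hx)
    rcases mul_eq_zero.mp h3' with hy | hB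
    · subst hy
      have hq : x ^ 2 + A * x + B = 0 := by
        have : x * (x ^ 2 + A * x + B) = 0 := by linear_combination -he
        exact (mul_eq_zero.mp this).resolve_left hx
      have hn' : 3 * x ^ 2 + 2 * A * x + B ≠ 0 := by
        rcases hn with h | h
        · exact h
        · exact absurd rfl h
      have h1' : A ^ 2 - 4 * B = 0 := by
        simpa using h1
      have hs : (2 * x + A) ^ 2 = 0 := by linear_combination h1' + 4 * hq
      have hs' : 2 * x + A = 0 := by simpa using hs
      apply hn'
      linear_combination hq + x * hs'
    · have hB' : B = x ^ 2 := sub_eq_zero.mp hB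
      have hX' : y ^ 2 / x ^ 2 = 2 * x + A := by
        rw [hX, hB']; field_simp; ring
      rw [hX'] at h1
      rw [hB'] at h1 hn he
      have hz : (2 * x + A) * (2 * 2 * x) = 0 := by linear_combination h1
      have hz' : 2 * x + A = 0 := by
        rcases mul_eq_zero.mp hz with h | h
        · exact h
        · exact absurd h (mul_ne_zero (mul_ne_zero h2 h2) hx)
      have hy : y = 0 := by
        have : y ^ 2 = 0 := by linear_combination he + x ^ 2 * hz'
        simpa using this
      rcases hn with h | h
      · apply h; linear_combination 2 * x * hz'
      · exact h hy

/-- The 2-isogeny `φ(x, y) = (y²/x², y (b - x²)/x²)` from `y² = x³ + a x² + b x` to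
`y² = x³ - 2 a x² + (a² - 4 b) x`, on `L`-rational points; it sends `O` and the points with
`x = 0` to `O`. -/
def phi : Pts a b L → Pts (-2 * a) (a ^ 2 - 4 * b) L
  | .zero => .zero
  | .some x y h =>
    open Classical in
    if hx : x = 0 then .zero
    else .some (y ^ 2 / x ^ 2) (y * (algebraMap k L b - x ^ 2) / x ^ 2) (phi_nonsingular a b h hx)

theorem phi_zero : phi a b (0 : Pts a b L) = 0 := rfl

theorem phi_some_eq_zero_iff {x y : L} (h : ((curve a b).baseChange L).Nonsingular x y) :
    phi a b (.some x y h : Pts a b L) = 0 ↔ x = 0 := by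
  by_cases hx : x = 0
  · have : phi a b (.some x y h : Pts a b L) = 0 := by
      simp only [phi, hx, dite_true]; rfl
    exact iff_of_true this hx
  · have h0 : phi a b (.some x y h : Pts a b L) ≠ 0 := by
      simp only [phi, hx, dite_false]
      exact WeierstrassCurve.Affine.Point.some_ne_zero _
    exact iff_of_false h0 hx

theorem y_eq_zero {y : L} (h : ((curve a b).baseChange L).Nonsingular 0 y) : y = 0 := by
  have := ((nonsingular_iff a b 0 y).mp h).1
  simpa using this

/-- A point of the kernel of `φ` is `O` or `(0, 0)`. -/
theorem phi_eq_zero_iff (P : Pts a b L) :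
    phi a b P = 0 ↔ P = 0 ∨ ∃ h, P = .some 0 0 h := by
  rcases P with _ | ⟨x, y, h⟩
  · exact ⟨fun _ => Or.inl rfl, fun _ => rfl⟩
  · rw [phi_some_eq_zero_iff]
    constructor
    · rintro rfl
      obtain rfl := y_eq_zero a b h
      exact Or.inr ⟨h, rfl⟩
    · rintro (h' | ⟨h', e⟩)
      · exact absurd h' (WeierstrassCurve.Affine.Point.some_ne_zero _)
      · exact (WeierstrassCurve.Affine.Point.some.inj e).1

open Classical in
theorem add_self_of_phi {P : Pts a b L} (h : phi a b P = 0) : P + P = 0 := by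
  rcases (phi_eq_zero_iff a b P).mp h with rfl | ⟨h', rfl⟩
  · simp
  · apply WeierstrassCurve.Affine.Point.add_self_of_Y_eq
    simp [WeierstrassCurve.Affine.negY, curve, WeierstrassCurve.Affine.baseChange]

variable (L) in
open Classical in
/-- The kernel `E[φ]` of the isogeny, as a subgroup of `E(L)`. -/
def kerPhi : AddSubgroup (Pts a b L) where
  carrier := {P | phi a b P = 0}
  zero_mem' := rfl
  add_mem' := by
    intro P Q hP hQ
    rcases (phi_eq_zero_iff a b P).mp hP with rfl | ⟨h, rfl⟩
    · simpa using hQ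
    rcases (phi_eq_zero_iff a b Q).mp hQ with rfl | ⟨h', rfl⟩
    · simpa using hP
    · exact congrArg (phi a b) (add_self_of_phi a b hP)
  neg_mem' := by
    intro P hP
    have : -P = P := by
      rw [neg_eq_iff_add_eq_zero]
      exact add_self_of_phi a b hP
    exact (congrArg (phi a b) this).trans hP

theorem mem_kerPhi {P : Pts a b L} : P ∈ kerPhi a b L ↔ phi a b P = 0 := Iff.rfl

/-- The nonzero point `(0, 0)` of `E[φ]`. -/
def kerPoint (hb : b ≠ 0) : kerPhi a b L :=
  ⟨.some 0 0 ((nonsingular_iff a b 0 0).mpr ⟨by simp, Or.inl (by simpa using hb)⟩),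
    (phi_some_eq_zero_iff a b _).mpr rfl⟩

end Isogeny

/-! ### First cohomology with continuous cochains -/

section Cohomology

variable {G M : Type*} [Group G] [TopologicalSpace G] [AddCommGroup M]
  (ρ : G →* AddMonoid.End M)

/-- Continuous 1-cocycles of `G` with values in the discrete module `M`. -/
def Z1 : AddSubgroup (G → M) where
  carrier := {c | IsLocallyConstant c ∧ ∀ σ τ, c (σ * τ) = c σ + ρ σ (c τ)}
  zero_mem' := ⟨IsLocallyConstant.const 0, by simp⟩
  add_mem' := by
    rintro c d ⟨hc, hc'⟩ ⟨hd, hd'⟩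
    refine ⟨hc.add hd, fun σ τ => ?_⟩
    simp only [Pi.add_apply, hc', hd', map_add]
    abel
  neg_mem' := by
    rintro c ⟨hc, hc'⟩
    refine ⟨hc.neg, fun σ τ => ?_⟩
    simp only [Pi.neg_apply, hc', map_neg]
    abel

/-- The 1-cocycles that are coboundaries `σ ↦ σ m - m`. -/
def B1 : AddSubgroup (Z1 ρ) where
  carrier := {c | ∃ m : M, ∀ σ, c.1 σ = ρ σ m - m}
  zero_mem' := ⟨0, by simp⟩
  add_mem' := by
    rintro c d ⟨m, hm⟩ ⟨m', hm'⟩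
    refine ⟨m + m', fun σ => ?_⟩
    simp only [AddSubgroup.coe_add, Pi.add_apply, hm, hm', map_add]
    abel
  neg_mem' := by
    rintro c ⟨m, hm⟩
    refine ⟨-m, fun σ => ?_⟩
    simp only [AddSubgroup.coe_neg, Pi.neg_apply, hm, map_neg]
    abel

/-- The cohomology group `H¹(G, M)`. -/
abbrev H1 : Type _ := Z1 ρ ⧸ B1 ρ

end Cohomology

/-! ### Galois action, localization and the Selmer group -/

section Galois

open Classical

/-- The absolute Galois group of `K`, with its Krull topology. -/
abbrev AbsGal (K : Type*) [Field K] : Type _ := AlgebraicClosure K ≃ₐ[K] AlgebraicClosure K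

variable {k : Type*} [Field k] [CharZero k] (a b : k)

/-- The action of `Gal(K̄/K)` on `E(K̄)`, for an extension `K` of `k`. -/
def galMap (K : Type*) [Field K] [Algebra k K] (σ : AbsGal K) :
    Pts a b (AlgebraicClosure K) →+ Pts a b (AlgebraicClosure K) :=
  WeierstrassCurve.Affine.Point.map (W' := curve a b) (σ : AlgebraicClosure K →ₐ[K] _)

/-- The map `E(k̄) → E(K̄)` induced by an embedding `k̄ → K̄` over `k`. -/
def embMap {K : Type*} [Field K] [Algebra k K] (j : AlgebraicClosure k →ₐ[k] AlgebraicClosure K) :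
    Pts a b (AlgebraicClosure k) →+ Pts a b (AlgebraicClosure K) :=
  WeierstrassCurve.Affine.Point.map (W' := curve a b) j

theorem galMap_of_mem (σ : AbsGal k) {P : Pts a b (AlgebraicClosure k)}
    (hP : P ∈ kerPhi a b (AlgebraicClosure k)) : galMap a b k σ P = P := by
  rcases (phi_eq_zero_iff a b P).mp hP with rfl | ⟨h, rfl⟩
  · exact map_zero _
  · simp [galMap, WeierstrassCurve.Affine.Point.map_some]

/-- The action of `Gal(k̄/k)` on `E[φ]`, restricted from its action on `E(k̄)`. -/
def galKer : AbsGal k →* AddMonoid.End (kerPhi a b (AlgebraicClosure k)) where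
  toFun σ := ((galMap a b k σ).comp (kerPhi a b (AlgebraicClosure k)).subtype).codRestrict _
    (fun P => (galMap_of_mem a b σ P.2).symm ▸ P.2)
  map_one' := by
    ext P
    exact galMap_of_mem a b 1 P.2
  map_mul' := by
    intro σ τ
    ext P
    refine (galMap_of_mem a b (σ * τ) P.2).trans ?_
    exact ((galMap_of_mem a b σ ((galMap_of_mem a b τ P.2).symm ▸ P.2)).trans
      (galMap_of_mem a b τ P.2)).symm

theorem galKer_apply (σ : AbsGal k) (P : kerPhi a b (AlgebraicClosure k)) :
    galKer a b σ P = P :=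
  Subtype.ext (galMap_of_mem a b σ P.2)

/-- The restriction `Gal(K̄/K) → Gal(k̄/k)` along an embedding `j : k̄ → K̄`. -/
def resGal {K : Type*} [Field K] [Algebra k K]
    (j : AlgebraicClosure k →ₐ[k] AlgebraicClosure K) (σ : AbsGal K) : AbsGal k :=
  letI : Algebra (AlgebraicClosure k) (AlgebraicClosure K) := j.toRingHom.toAlgebra
  haveI : IsScalarTower k (AlgebraicClosure k) (AlgebraicClosure K) :=
    IsScalarTower.of_algebraMap_eq fun x => (j.commutes x).symm
  AlgEquiv.restrictNormal (σ.restrictScalars k) (AlgebraicClosure k)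

theorem resGal_spec {K : Type*} [Field K] [Algebra k K]
    (j : AlgebraicClosure k →ₐ[k] AlgebraicClosure K) (σ : AbsGal K) (x : AlgebraicClosure k) :
    j (resGal j σ x) = σ (j x) := by
  let _ : Algebra (AlgebraicClosure k) (AlgebraicClosure K) := j.toRingHom.toAlgebra
  have _ : IsScalarTower k (AlgebraicClosure k) (AlgebraicClosure K) :=
    IsScalarTower.of_algebraMap_eq fun x => (j.commutes x).symm
  exact AlgEquiv.restrictNormal_commutes (σ.restrictScalars k) (AlgebraicClosure k) x

/-- The cocycles `c` with values in `E[φ]` whose image in `H¹(Gal(K̄/K), E(K̄))` is trivial: for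
every embedding `j : k̄ → K̄`, the restriction `σ ↦ j (c (σ|k̄))` is the coboundary
`σ ↦ σ P - P` of some point `P` of `E(K̄)`. -/
def locallyTrivial (K : Type*) [Field K] [Algebra k K] : AddSubgroup (Z1 (galKer a b)) where
  carrier := {c | ∀ j : AlgebraicClosure k →ₐ[k] AlgebraicClosure K,
    ∃ P : Pts a b (AlgebraicClosure K), ∀ σ : AbsGal K,
      embMap a b j (c.1 (resGal j σ)) = galMap a b K σ P - P}
  zero_mem' := fun j => ⟨0, fun σ => by
    rw [map_zero, sub_zero]
    exact map_zero _⟩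
  add_mem' := by
    intro c d hc hd j
    obtain ⟨P, hP⟩ := hc j
    obtain ⟨Q, hQ⟩ := hd j
    refine ⟨P + Q, fun σ => ?_⟩
    have h : embMap a b j ((c + d).1 (resGal j σ)) =
        embMap a b j (c.1 (resGal j σ)) + embMap a b j (d.1 (resGal j σ)) := map_add _ _ _
    rw [h, hP, hQ, map_add]
    abel
  neg_mem' := by
    intro c hc j
    obtain ⟨P, hP⟩ := hc j
    refine ⟨-P, fun σ => ?_⟩
    have h : embMap a b j ((-c).1 (resGal j σ)) = -embMap a b j (c.1 (resGal j σ)) := map_neg _ _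
    rw [h, hP, map_neg]
    abel

theorem two_nsmul_H1 (x : H1 (galKer a b)) : 2 • x = 0 := by
  obtain ⟨c, rfl⟩ := QuotientAddGroup.mk_surjective x
  have : 2 • c = 0 := by
    apply Subtype.ext
    funext σ
    apply Subtype.ext
    exact (two_nsmul _).trans (add_self_of_phi a b (c.1 σ).2)
  rw [← QuotientAddGroup.mk_nsmul, this, QuotientAddGroup.mk_zero]

/-! ### The Kummer map -/

/-- The group `kˣ / (kˣ)²`, written additively. -/
abbrev SqClass (k : Type*) [Field k] : Type _ :=
  Additive (kˣ ⧸ (powMonoidHom 2 : kˣ →* kˣ).range)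

variable {b}

/-- The function `σ ↦ O` if `σ r = r`, and `σ ↦ (0, 0)` otherwise. -/
def signFun (hb : b ≠ 0) (r : AlgebraicClosure k) (σ : AbsGal k) :
    kerPhi a b (AlgebraicClosure k) :=
  if σ r = r then 0 else kerPoint a b hb

theorem kerPoint_add_self (hb : b ≠ 0) :
    (kerPoint a b hb + kerPoint a b hb : kerPhi a b (AlgebraicClosure k)) = 0 :=
  Subtype.ext (add_self_of_phi a b (kerPoint a b hb).2)

theorem apply_eq_or {r : AlgebraicClosure k} {u : k} (hr : r ^ 2 = algebraMap k _ u)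
    (σ : AbsGal k) : σ r = r ∨ σ r = -r := by
  apply sq_eq_sq_iff_eq_or_eq_neg.mp
  rw [← map_pow, hr, AlgEquiv.commutes]

theorem neg_ne {r : AlgebraicClosure k} (h0 : r ≠ 0) : -r ≠ r := by
  have : CharZero (AlgebraicClosure k) :=
    charZero_of_injective_algebraMap (algebraMap k (AlgebraicClosure k)).injective
  exact neg_ne_self.mpr h0

theorem signFun_mul (hb : b ≠ 0) {r s : AlgebraicClosure k} {u v : k} (hr0 : r ≠ 0) (hs0 : s ≠ 0)
    (hr : r ^ 2 = algebraMap k _ u) (hs : s ^ 2 = algebraMap k _ v) (σ : AbsGal k) :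
    signFun a hb (r * s) σ = signFun a hb r σ + signFun a hb s σ := by
  have h1 := neg_ne hr0
  have h2 := neg_ne hs0
  have h3 := neg_ne (mul_ne_zero hr0 hs0)
  unfold signFun
  rcases apply_eq_or hr σ with h | h <;> rcases apply_eq_or hs σ with h' | h' <;>
    simp [h, h', h1, h2, h3, kerPoint_add_self]

/-- Two square roots of the same element define the same function. -/
theorem signFun_eq (hb : b ≠ 0) {r s : AlgebraicClosure k} (h : r ^ 2 = s ^ 2) (σ : AbsGal k) :
    signFun a hb r σ = signFun a hb s σ := by
  rcases sq_eq_sq_iff_eq_or_eq_neg.mp h with rfl | rfl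
  · rfl
  · simp [signFun]

theorem signFun_mem (hb : b ≠ 0) {r : AlgebraicClosure k} {u : k} (h0 : r ≠ 0)
    (hr : r ^ 2 = algebraMap k _ u) : signFun a hb r ∈ Z1 (galKer a b) := by
  refine ⟨?_, fun σ τ => ?_⟩
  · rw [IsLocallyConstant.iff_exists_open]
    intro σ
    have ho : IsOpen (MulAction.stabilizer (AbsGal k) r : Set (AbsGal k)) :=
      stabilizer_isOpen_of_isIntegral (K := k) r
    refine ⟨(fun τ => σ⁻¹ * τ) ⁻¹' (MulAction.stabilizer (AbsGal k) r : Set (AbsGal k)),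
      ho.preimage (continuous_const_mul σ⁻¹), by simp, fun τ hτ => ?_⟩
    have h1 : (σ⁻¹ * τ) r = r := hτ
    have h2 : τ r = σ r := by
      have := congrArg σ h1
      rwa [← AlgEquiv.mul_apply, mul_inv_cancel_left] at this
    simp [signFun, h2]
  · rw [galKer_apply]
    have h1 := neg_ne h0
    unfold signFun
    rcases apply_eq_or hr σ with h | h <;> rcases apply_eq_or hr τ with h' | h' <;>
      simp [h, h', h1, kerPoint_add_self]

theorem exists_sqrt (u : kˣ) : ∃ r : AlgebraicClosure k, r ^ 2 = algebraMap k _ (u : k) :=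
  IsAlgClosed.exists_pow_nat_eq _ two_pos

/-- A chosen square root of `u` in `k̄`. -/
def sqrtU (u : kˣ) : AlgebraicClosure k := (exists_sqrt u).choose

theorem sqrtU_sq (u : kˣ) : sqrtU u ^ 2 = algebraMap k _ (u : k) := (exists_sqrt u).choose_spec

theorem sqrtU_ne_zero (u : kˣ) : sqrtU u ≠ 0 := by
  intro h
  have := sqrtU_sq u
  rw [h, zero_pow two_ne_zero] at this
  exact u.ne_zero ((map_eq_zero (algebraMap k (AlgebraicClosure k))).mp this.symm)

/-- The class in `H¹(Gal(k̄/k), E[φ])` of the cocycle sending `σ` to `O` or `(0, 0)`, according to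
whether `σ √u = √u` or `σ √u = -√u`. -/
def kummerUnits (hb : b ≠ 0) : kˣ →* Multiplicative (H1 (galKer a b)) where
  toFun u := Multiplicative.ofAdd (QuotientAddGroup.mk
    ⟨signFun a hb (sqrtU u), signFun_mem a hb (sqrtU_ne_zero u) (sqrtU_sq u)⟩)
  map_one' := by
    rw [← ofAdd_zero, ← QuotientAddGroup.mk_zero]
    congr 2
    apply Subtype.ext
    funext σ
    have : signFun a hb (sqrtU 1) σ = signFun a hb 1 σ :=
      signFun_eq a hb (by rw [sqrtU_sq]; simp) σ
    refine this.trans ?_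
    simp [signFun]
  map_mul' u v := by
    rw [← ofAdd_add, ← QuotientAddGroup.mk_add]
    congr 2
    apply Subtype.ext
    funext σ
    have h : signFun a hb (sqrtU (u * v)) σ = signFun a hb (sqrtU u * sqrtU v) σ :=
      signFun_eq a hb (by rw [mul_pow, sqrtU_sq, sqrtU_sq, sqrtU_sq]; simp) σ
    exact h.trans (signFun_mul a hb (sqrtU_ne_zero u) (sqrtU_ne_zero v) (sqrtU_sq u) (sqrtU_sq v) σ)

/-- The Kummer homomorphism `kˣ / (kˣ)² → H¹(Gal(k̄/k), E[φ])` coming from `E[φ] ≅ μ₂`. -/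
def kummer (hb : b ≠ 0) : SqClass k →+ H1 (galKer a b) :=
  MonoidHom.toAdditiveLeft (QuotientGroup.lift _ (kummerUnits a hb) (by
    rintro _ ⟨u, rfl⟩
    rw [powMonoidHom_apply, MonoidHom.mem_ker, map_pow]
    exact congrArg Multiplicative.ofAdd (two_nsmul_H1 a b (kummerUnits a hb u).toAdd)))

end Galois

/-! ### The Selmer group over `ℚ` -/

section Rational

variable (a b : ℚ)

/-- The Selmer group `S^(φ)(E/ℚ)`: the classes in `H¹(Gal(ℚ̄/ℚ), E[φ])` that become trivial in
`H¹(Gal(ℚ̄_v/ℚ_v), E(ℚ̄_v))` for every place `v` of `ℚ`, that is, for every field `ℚ_ℓ` and for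
`ℝ`. -/
def selmer : AddSubgroup (H1 (galKer a b)) :=
  ((⨅ ℓ : Nat.Primes, haveI : Fact (ℓ : ℕ).Prime := ⟨ℓ.2⟩; locallyTrivial a b ℚ_[(ℓ : ℕ)]) ⊓
    locallyTrivial a b ℝ).map (QuotientAddGroup.mk' (B1 (galKer a b)))

/-- Whether a class lies in `S^(φ)(E/ℚ)` can be tested on any cocycle in it. -/
theorem mk_mem_selmer_iff (c : Z1 (galKer a b)) :
    (QuotientAddGroup.mk c : H1 (galKer a b)) ∈ selmer a b ↔
      (∀ (ℓ : ℕ) [Fact ℓ.Prime], c ∈ locallyTrivial a b ℚ_[ℓ]) ∧ c ∈ locallyTrivial a b ℝ := by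
  have hB : B1 (galKer a b) = ⊥ := by
    rw [eq_bot_iff]
    rintro d ⟨m, hm⟩
    rw [AddSubgroup.mem_bot]
    apply Subtype.ext
    funext σ
    rw [hm, galKer_apply, sub_self]
    rfl
  have key : (QuotientAddGroup.mk c : H1 (galKer a b)) ∈ selmer a b ↔
      c ∈ ((⨅ ℓ : Nat.Primes, haveI : Fact (ℓ : ℕ).Prime := ⟨ℓ.2⟩;
        locallyTrivial a b ℚ_[(ℓ : ℕ)]) ⊓ locallyTrivial a b ℝ) := by
    constructor
    · rintro ⟨d, hd, e⟩
      have e' : (QuotientAddGroup.mk d : H1 (galKer a b)) = QuotientAddGroup.mk c := e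
      rw [QuotientAddGroup.eq, hB, AddSubgroup.mem_bot, neg_add_eq_zero] at e'
      exact e' ▸ hd
    · exact fun h => ⟨c, h, rfl⟩
  rw [key, AddSubgroup.mem_inf, AddSubgroup.mem_iInf]
  exact and_congr_left' ⟨fun h ℓ hℓ => h ⟨ℓ, hℓ.out⟩, fun h ℓ => @h ℓ ⟨ℓ.2⟩⟩

/-- `S^(φ)(E/ℚ)` is killed by 2, hence it is a vector space over `ℤ/2ℤ`. -/
instance selmerModule : Module (ZMod 2) (selmer a b) :=
  AddCommGroup.zmodModule fun x => Subtype.ext (two_nsmul_H1 a b x.1)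

/-- The subgroup `⟨T⟩` of `ℚˣ / (ℚˣ)²` generated by the classes of the elements of `T`. -/
def spanSq (T : Finset ℕ) : AddSubgroup (SqClass ℚ) :=
  AddSubgroup.closure {x | ∃ u : ℚˣ, (∃ t ∈ T, (u : ℚ) = t) ∧
    x = Additive.ofMul (QuotientGroup.mk u)}

end Rational

/-! ### The curve `y² = x (x + p D) (x + q D)` and the function `ρ⁺(D)` -/

section Family

open scoped NumberTheorySymbols

variable (p q : ℕ) {n : ℕ} (D : Fin n → ℕ)

/-- The product `D = D₁ ⋯ Dₙ`. -/
def bigD : ℕ := ∏ i, D i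

/-- The product `D / Dᵢ` of the other primes. -/
def hatD (i : Fin n) : ℕ := ∏ j ∈ Finset.univ.erase i, D j

/-- The coefficient of `x²` in `x (x + p D) (x + q D)`. -/
def coeffA : ℚ := ((p : ℚ) + q) * bigD D

/-- The coefficient of `x` in `x (x + p D) (x + q D)`. -/
def coeffB : ℚ := (p : ℚ) * q * (bigD D : ℚ) ^ 2

theorem coeffB_ne_zero {p q : ℕ} {D : Fin n → ℕ} (hp : p.Prime) (hq : q.Prime)
    (hD : ∀ i, (D i).Prime) : coeffB p q D ≠ 0 := by
  have h : bigD D ≠ 0 := Finset.prod_ne_zero_iff.mpr fun i _ => (hD i).ne_zero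
  have h1 := hp.ne_zero
  have h2 := hq.ne_zero
  unfold coeffB
  positivity

/-- The curve `curve (coeffA p q D) (coeffB p q D)` is `y² = x (x + p D) (x + q D)`. -/
theorem equation_iff (x y : ℚ) : (curve (coeffA p q D) (coeffB p q D)).Equation x y ↔
    y ^ 2 = x * (x + p * bigD D) * (x + q * bigD D) := by
  rw [WeierstrassCurve.Affine.equation_iff]
  simp only [curve, coeffA, coeffB]
  constructor <;> intro h <;> linear_combination h

/-- If `q - p = 2 ^ m`, the isogenous curve is `y² = x³ - 2 (p + q) D x² + 4 ^ m D² x`. -/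
theorem isogenous_coeff {p q m : ℕ} (h : q = p + 2 ^ m) (D : Fin n → ℕ) :
    -2 * coeffA p q D = -2 * ((p : ℚ) + q) * bigD D ∧
      coeffA p q D ^ 2 - 4 * coeffB p q D = 4 ^ m * (bigD D : ℚ) ^ 2 := by
  subst h
  have h4 : (4 : ℚ) ^ m = (2 ^ m) ^ 2 := by
    rw [← pow_mul, mul_comm, pow_mul]; norm_num
  rw [h4]
  unfold coeffA coeffB
  push_cast
  constructor <;> ring

open Classical in
/-- `δᵢ` for `1 ≤ i ≤ n`. -/
def delta (m : ℕ) (i : Fin n) : ℤ :=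
  if (D i : ℤ) ≡ 1 [ZMOD 4] ∨ (m = 2 ∧ (p : ℤ) - bigD D ≡ 2 [ZMOD 8]) ∨
    (3 ≤ m ∧ (p : ℤ) + bigD D ≡ 0 [ZMOD 4]) then 0 else 1

open Classical in
/-- `δₙ₊₁`. -/
def deltaLast (m : ℕ) : ℤ :=
  if (m = 3 ∧ (p : ℤ) * bigD D ≡ -1 [ZMOD 8]) ∨ (m = 4 ∧ (p : ℤ) * bigD D ≡ 1 [ZMOD 8]) ∨
    5 ≤ m then 0 else 1

/-- `Πᵢ⁺(D)` for `1 ≤ i ≤ n`. All the lower entries are odd primes, so that the symbols are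
Legendre symbols. -/
def bigPi (m : ℕ) (i : Fin n) : ℤ :=
  delta p D m i + (1 - J((q * hatD D i : ℕ) | D i)) * (1 - J((p * hatD D i : ℕ) | D i)) +
    ∑ l ∈ (p * q * hatD D i).primeFactors, (1 - J(D i | l))

/-- `Πₙ₊₁⁺(D)`. -/
def bigPiLast (m : ℕ) : ℤ :=
  deltaLast p D m + ∑ l ∈ (p * q * bigD D).primeFactors, (1 - J(2 | l))

/-- `ρ⁺(D)`, the sum of the integral parts of `1 / (1 + Πᵢ⁺(D))` for `1 ≤ i ≤ n + 1`; these
fractions are positive, since `Πᵢ⁺(D) ≥ 0`. -/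
def rho (m : ℕ) : ℕ :=
  ∑ i, ⌊(1 : ℚ) / (1 + bigPi p q D m i)⌋₊ + ⌊(1 : ℚ) / (1 + bigPiLast p q D m)⌋₊

end Family

end

end TwoIsogenySelmer

namespace TwoIsogenySelmer

/-! Each Πᵢ⁺(D) is a sum of nonnegative integers, so ⌊1/(1+Πᵢ⁺)⌋ is 1 if Πᵢ⁺ = 0 and 0 otherwise.
Hence ρ⁺(D) counts the elements d of {D₁, …, Dₙ, 2} whose Π vanishes, and T is the set of these d
(`selmerPrimes`). Distinct primes are independent modulo squares (`linearIndependent_natClass`) and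
the Kummer map is injective (`kummer_injective`), so it remains to show that each such d is a Selmer
class.

By descent, the class of d dies in H¹(K, E) if d is a square in K or if E'(K) has a point whose
X-coordinate is d times a nonzero square (`signFun_mem_locallyTrivial`). The places of ℚ are then
treated as follows. At ∞, d is positive, hence a square. At an odd ℓ dividing pqD but not d, the
vanishing Legendre sum makes d a square in ℚ_ℓ. At an odd ℓ not dividing pqDd, a counting argument
modulo ℓ and Hensel's lemma give a point (`torsorSolvable_of_good_reduction`). At ℓ = d = Dᵢ,
reciprocity and q ≡ p (mod 4) give (p/d) = (q/d). The product term in Πᵢ⁺ then makes both pq and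
pD/d squares in ℚ_d, and a 2-torsion point of E' has the class of d (`torsorSolvable_of_isSquare`).
At 2, δ = 0 lists the congruences under which d is a square or points are written down by hand
(`torsorSolvable_two_of_mod_four_eq_one`, `torsorSolvable_two_of_eq_two`,
`torsorSolvable_two_of_three_le`, `torsorSolvable_two_two`). -/

/-- The fibre over `d` of the connecting map `(X, Y) ↦ X` on `Y² = X (X² - 2 a X + a² - 4 b)` is
nonempty, in a form that suffices for local triviality of the class of `d`. -/
def TorsorSolvable {K : Type*} [Field K] (a b d : K) : Prop :=
  IsSquare d ∨ ∃ s Y : K, s ≠ 0 ∧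
    Y ^ 2 = d * s ^ 2 * ((d * s ^ 2) ^ 2 - 2 * a * (d * s ^ 2) + (a ^ 2 - 4 * b))

/-! ### Local triviality from points on the isogenous curve -/

section Cocycle

open Classical

variable {k : Type*} [Field k] [CharZero k] (a b : k)

theorem signFun_of_fixed (hb : b ≠ 0) {r : AlgebraicClosure k} {σ : AbsGal k} (h : σ r = r) :
    signFun a hb r σ = 0 := by
  simp [signFun, h]

theorem signFun_of_not_fixed (hb : b ≠ 0) {r : AlgebraicClosure k} {σ : AbsGal k} (h : σ r ≠ r) :
    signFun a hb r σ = kerPoint a b hb := by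
  simp [signFun, h]

theorem resGal_fixed_iff {K : Type*} [Field K] [Algebra k K]
    (j : AlgebraicClosure k →ₐ[k] AlgebraicClosure K) (σ : AbsGal K) (r : AlgebraicClosure k) :
    resGal j σ r = r ↔ σ (j r) = j r := by
  rw [← resGal_spec]
  exact j.injective.eq_iff.symm

/-- A point (X, Y) of E'(K) with X = u s² has a φ-preimage P over K(√u). An automorphism negating √u
moves P to P + (0, 0), so the Kummer cocycle is the coboundary of P. -/
theorem signFun_mem_locallyTrivial (hb : b ≠ 0) (u : kˣ) {K : Type*} [Field K] [Algebra k K]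
    (h : TorsorSolvable (algebraMap k K a) (algebraMap k K b) (algebraMap k K u)) :
    (⟨signFun a hb (sqrtU u), signFun_mem a hb (sqrtU_ne_zero u) (sqrtU_sq u)⟩ :
      Z1 (galKer a b)) ∈ locallyTrivial a b K := by
  intro j
  have hcK : CharZero K := charZero_of_injective_algebraMap (algebraMap k K).injective
  have hc : CharZero (AlgebraicClosure K) :=
    charZero_of_injective_algebraMap (algebraMap K (AlgebraicClosure K)).injective
  set r := j (sqrtU u) with hr
  have hr2 : r ^ 2 = algebraMap K (AlgebraicClosure K) (algebraMap k K u) := by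
    rw [hr, ← map_pow, sqrtU_sq, AlgHom.commutes]
    exact IsScalarTower.algebraMap_apply k K (AlgebraicClosure K) u
  have hr0 : r ≠ 0 := by
    rw [hr]; exact (map_ne_zero_iff j j.injective).mpr (sqrtU_ne_zero u)
  rcases h with ⟨s, hs⟩ | ⟨s, Y, hs0, hY⟩
  · refine ⟨0, fun σ => ?_⟩
    have hfix : σ r = r := by
      have : r ^ 2 = (algebraMap K (AlgebraicClosure K) s) ^ 2 := by
        rw [hr2, hs, map_mul, sq]
      rcases sq_eq_sq_iff_eq_or_eq_neg.mp this with h | h <;> rw [h] <;> simp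
    have h1 : signFun a hb (sqrtU u) (resGal j σ) = 0 :=
      signFun_of_fixed a b hb ((resGal_fixed_iff j σ _).mpr hfix)
    change embMap a b j ((signFun a hb (sqrtU u) (resGal j σ)).1) = _
    rw [h1, map_zero, sub_zero]
    exact map_zero _
  · set ι := algebraMap K (AlgebraicClosure K) with hι
    set A := algebraMap k (AlgebraicClosure K) a with hA
    set B := algebraMap k (AlgebraicClosure K) b with hB
    have hAι : ι (algebraMap k K a) = A :=
      (IsScalarTower.algebraMap_apply k K (AlgebraicClosure K) a).symm
    have hBι : ι (algebraMap k K b) = B :=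
      (IsScalarTower.algebraMap_apply k K (AlgebraicClosure K) b).symm
    have hB0 : B ≠ 0 := (map_ne_zero (algebraMap k (AlgebraicClosure K))).mpr hb
    -- R is a square root of X = u s². As φ has first coordinate (y/x)², the preimage is sought on
    -- the line y = R x, where x solves t² - (R² - A) t + B = 0. Its discriminant is V².
    set R := r * ι s with hR
    have hR0 : R ≠ 0 := mul_ne_zero hr0 ((map_ne_zero ι).mpr hs0)
    have hY' : (ι Y) ^ 2 = R ^ 2 * ((R ^ 2) ^ 2 - 2 * A * R ^ 2 + (A ^ 2 - 4 * B)) := by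
      have := congrArg ι hY
      simp only [map_mul, map_add, map_sub, map_pow, map_ofNat, hAι, hBι, ← hr2] at this
      rw [this, hR]; ring
    set V := ι Y / R with hV
    have hV2 : V ^ 2 = (R ^ 2) ^ 2 - 2 * A * R ^ 2 + (A ^ 2 - 4 * B) := by
      rw [hV, div_pow, hY']; field_simp
    set x := (R ^ 2 - A - V) / 2 with hx
    set x' := (R ^ 2 - A + V) / 2 with hx'
    have hxx : x * x' = B := by
      rw [hx, hx']; linear_combination (-1 / 4) * hV2
    have hxs : x + x' = R ^ 2 - A := by rw [hx, hx']; ring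
    have hx0 : x ≠ 0 := fun h => hB0 (by rw [← hxx, h, zero_mul])
    have ns : ((curve a b).baseChange (AlgebraicClosure K)).Nonsingular x (R * x) := by
      rw [nonsingular_iff]
      refine ⟨?_, Or.inr (mul_ne_zero hR0 hx0)⟩
      rw [← hA, ← hB, ← hxx]
      linear_combination (-x ^ 2) * hxs
    refine ⟨.some x (R * x) ns, fun σ => ?_⟩
    have hσι : ∀ z : K, σ (ι z) = ι z := fun z => σ.commutes z
    have hσA : σ A = A := by rw [← hAι, hσι]
    have hσ2 : σ 2 = 2 := map_ofNat σ 2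
    change embMap a b j ((signFun a hb (sqrtU u) (resGal j σ)).1) = _
    rw [eq_sub_iff_add_eq]
    by_cases hfix : σ r = r
    · rw [signFun_of_fixed a b hb ((resGal_fixed_iff j σ _).mpr hfix)]
      have hσR : σ R = R := by rw [hR, map_mul, hfix, hσι]
      have hσx : σ x = x := by simp [hx, hV, hσR, hσι, hσA, hσ2]
      have h0 : embMap a b j ((0 : kerPhi a b (AlgebraicClosure k)) :
          Pts a b (AlgebraicClosure k)) = 0 := map_zero _
      rw [h0, zero_add]
      simp [galMap, WeierstrassCurve.Affine.Point.map_some, hσR, hσx]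
    · have hneg : σ r = -r := by
        have : (σ r) ^ 2 = r ^ 2 := by rw [← map_pow, hr2, hσι]
        exact (sq_eq_sq_iff_eq_or_eq_neg.mp this).resolve_left hfix
      rw [signFun_of_not_fixed a b hb (fun h => hfix ((resGal_fixed_iff j σ _).mp h))]
      have hσR : σ R = -R := by rw [hR, map_mul, hneg, hσι, neg_mul]
      -- Negating R negates V and so exchanges the two roots. Since x x' = B, this is translation by
      -- (0, 0); the chord through (0, 0) and P has slope R.
      have hσx : σ x = x' := by
        simp [hx, hx', hV, hσR, hσι, hσA, hσ2, div_neg]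
      simp only [kerPoint, embMap, galMap, WeierstrassCurve.Affine.Point.map_some]
      rw [WeierstrassCurve.Affine.Point.add_of_X_ne (by simpa using hx0.symm)]
      have hsl : WeierstrassCurve.Affine.slope ((curve a b).baseChange (AlgebraicClosure K))
          (j 0) x (j 0) (R * x) = R := by
        rw [WeierstrassCurve.Affine.slope_of_X_ne (by simpa using hx0.symm)]
        simp [hx0]
      have hX : WeierstrassCurve.Affine.addX ((curve a b).baseChange (AlgebraicClosure K))
          (j 0) x R = x' := by
        simp [WeierstrassCurve.Affine.addX, curve, WeierstrassCurve.Affine.baseChange]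
        linear_combination -hxs
      simp only [hsl, hX]
      have hYY : WeierstrassCurve.Affine.addY ((curve a b).baseChange (AlgebraicClosure K))
          (j 0) x (j 0) R = -R * x' := by
        rw [WeierstrassCurve.Affine.addY, WeierstrassCurve.Affine.negAddY, hX,
          WeierstrassCurve.Affine.negY]
        simp [curve]
      simp only [hYY]
      simp [hσR, hσx]

end Cocycle
/-! ### Squares in `ℤ_[ℓ]` -/

section Squares

/-- Hensel's lemma at a simple root. The residue of the lifted root is recorded because a second
square root is later extracted from an expression containing it. -/
theorem isSquare_of_toZMod {ℓ : ℕ} [Fact ℓ.Prime] (hℓ : ℓ ≠ 2) {u : ℤ_[ℓ]} {v : ZMod ℓ}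
    (hv : v ≠ 0) (h : PadicInt.toZMod u = v ^ 2) :
    ∃ r : ℤ_[ℓ], r ^ 2 = u ∧ PadicInt.toZMod r = v := by
  have hker : ∀ x : ℤ_[ℓ], PadicInt.toZMod x = 0 ↔ ‖x‖ < 1 := fun x => by
    rw [← RingHom.mem_ker, PadicInt.ker_toZMod, IsLocalRing.mem_maximalIdeal, PadicInt.mem_nonunits]
  obtain ⟨w, rfl⟩ := ZMod.ringHom_surjective (PadicInt.toZMod (p := ℓ)) v
  have h2 : (2 : ZMod ℓ) ≠ 0 := by
    intro h0
    have : ((2 : ℕ) : ZMod ℓ) = 0 := by exact_mod_cast h0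
    rw [ZMod.natCast_eq_zero_iff] at this
    exact hℓ ((Nat.prime_dvd_prime_iff_eq Fact.out Nat.prime_two).mp this)
  have hd : ‖2 * w‖ = 1 := by
    refine le_antisymm (PadicInt.norm_le_one _) (not_lt.mp fun hlt => ?_)
    rw [← hker, map_mul, map_ofNat] at hlt
    exact mul_ne_zero h2 hv hlt
  have hn : ‖w ^ 2 - u‖ < 1 := by rw [← hker, map_sub, map_pow, h, sub_self]
  obtain ⟨z, hz, hz1, -⟩ := hensels_lemma (F := (Polynomial.X ^ 2 - Polynomial.C u : Polynomial ℤ_[ℓ]))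
    (a := w) (by simpa [hd, one_add_one_eq_two] using hn)
  refine ⟨z, by simpa [sub_eq_zero] using hz, ?_⟩
  rw [← sub_eq_zero, ← map_sub, hker]
  simpa [hd, one_add_one_eq_two] using hz1

theorem isSquare_intCast {ℓ : ℕ} [Fact ℓ.Prime] (hℓ : ℓ ≠ 2) {u : ℤ} (hu : (u : ZMod ℓ) ≠ 0)
    (h : IsSquare (u : ZMod ℓ)) : IsSquare (u : ℚ_[ℓ]) := by
  obtain ⟨v, hv⟩ := h
  have hv0 : v ≠ 0 := by rintro rfl; exact hu (by simpa using hv)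
  obtain ⟨r, hr, -⟩ := isSquare_of_toZMod hℓ (u := (u : ℤ_[ℓ])) hv0 (by rw [map_intCast, hv, sq])
  refine ⟨r, ?_⟩
  rw [← sq]; exact_mod_cast congrArg (fun z : ℤ_[ℓ] => (z : ℚ_[ℓ])) hr.symm

/-- Hensel's lemma at 1 applies because |1 - u| ≤ 1/8 < 1/4 = |2|². -/
theorem exists_sq_eq_of_toZModPow_three {u : ℤ_[2]} (h : PadicInt.toZModPow 3 u = 1) :
    ∃ r : ℤ_[2], r ^ 2 = u := by
  have hn : ‖u - 1‖ ≤ (2 : ℝ) ^ (-3 : ℤ) := by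
    have : u - 1 ∈ RingHom.ker (PadicInt.toZModPow (p := 2) 3) := by
      rw [RingHom.mem_ker, map_sub, h, map_one, sub_self]
    rw [PadicInt.ker_toZModPow, ← PadicInt.norm_le_pow_iff_mem_span_pow] at this
    exact_mod_cast this
  have h2 : ‖(2 : ℤ_[2])‖ = 2⁻¹ := by exact_mod_cast PadicInt.norm_p (p := 2)
  obtain ⟨z, hz, -⟩ := hensels_lemma (F := (Polynomial.X ^ 2 - Polynomial.C u : Polynomial ℤ_[2]))
    (a := 1) (by
      have e1 : (Polynomial.X ^ 2 - Polynomial.C u : Polynomial ℤ_[2]).aeval (1 : ℤ_[2]) = 1 - u := by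
        simp
      have e2 : (Polynomial.X ^ 2 - Polynomial.C u : Polynomial ℤ_[2]).derivative.aeval
          (1 : ℤ_[2]) = 2 := by
        simp [one_add_one_eq_two]
      rw [e1, e2, h2, norm_sub_rev]
      refine lt_of_le_of_lt hn ?_
      norm_num)
  exact ⟨z, by simpa [sub_eq_zero] using hz⟩

theorem isSquare_intCast_two {u : ℤ} (h : (u : ZMod 8) = 1) : IsSquare (u : ℚ_[2]) := by
  obtain ⟨r, hr⟩ := exists_sq_eq_of_toZModPow_three (u := (u : ℤ_[2])) (by rw [map_intCast]; exact h)
  refine ⟨r, ?_⟩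
  rw [← sq]; exact_mod_cast congrArg (fun z : ℤ_[2] => (z : ℚ_[2])) hr.symm

end Squares

/-! ### Solvability at odd places of good reduction -/

section GoodReduction

/-- An injection argument in place of a point-count bound. If no v worked, the equation t² - (d v² -
A - B) t + AB = 0 would have nonzero roots in F for every v ≠ 0. Choosing one root for each v gives
an injection t of F into itself with t(0) = 0, but -A is never a value. The case A = B is allowed.
-/
theorem exists_nonsquare_root {F : Type*} [Field F] [Finite F] (h2 : (2 : F) ≠ 0) {A B d : F}
    (hA : A ≠ 0) (hB : B ≠ 0) (hd : d ≠ 0)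
    (hsq : ∀ x y : F, ¬ IsSquare x → ¬ IsSquare y → IsSquare (x * y))
    (hnd : ¬ IsSquare d) :
    ∃ v : F, v ≠ 0 ∧ (((d * v ^ 2 - A - B) ^ 2 = 4 * (A * B)) ∨
      ∃ y : F, y ≠ 0 ∧ y ^ 2 = d * v ^ 2 * ((d * v ^ 2 - A - B) ^ 2 - 4 * (A * B))) := by
  classical
  by_contra! hcon
  -- The square root of the discriminant is written v k with k depending only on X = d v², so that v
  -- and -v select opposite roots.
  have key : ∀ X : F, ∃ k : F, ∀ v : F, v ≠ 0 → X = d * v ^ 2 →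
      (v * k) ^ 2 = (X - A - B) ^ 2 - 4 * (A * B) ∧ k ≠ 0 := by
    intro X
    by_cases hX : ∃ v : F, v ≠ 0 ∧ X = d * v ^ 2
    · obtain ⟨v, hv, rfl⟩ := hX
      obtain ⟨h1, h3⟩ := hcon v hv
      set f := (d * v ^ 2 - A - B) ^ 2 - 4 * (A * B) with hf
      have hf0 : f ≠ 0 := sub_ne_zero.mpr h1
      -- If f were a nonsquare, d f would be a nonzero square, giving an excluded y.
      have hfs : IsSquare f := by
        by_contra hns
        obtain ⟨y, hy⟩ := hsq d f hnd hns
        refine h3 (y * v) (mul_ne_zero ?_ hv) (by linear_combination (-v ^ 2) * hy)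
        rintro rfl
        exact mul_ne_zero hd hf0 (by simpa using hy)
      obtain ⟨w, hw⟩ := hfs
      have hw0 : w ≠ 0 := by rintro rfl; exact hf0 (by simpa using hw)
      refine ⟨w / v, fun v' hv' e => ⟨?_, div_ne_zero hw0 hv⟩⟩
      have e' : v ^ 2 = v' ^ 2 := mul_left_cancel₀ hd e
      rw [mul_pow, div_pow, ← e', hw]
      field_simp
    · exact ⟨0, fun v hv e => absurd ⟨v, hv, e⟩ hX⟩
  choose k hk using key
  let t : F → F := fun v => if v = 0 then 0 else (d * v ^ 2 - A - B + v * k (d * v ^ 2)) / 2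
  have ht : ∀ v, v ≠ 0 → t v * (d * v ^ 2 - A - B - t v) = A * B := by
    intro v hv
    have := (hk (d * v ^ 2) v hv rfl).1
    simp only [t, hv, if_false]
    field_simp
    linear_combination -this
  have ht0 : ∀ v, v ≠ 0 → t v ≠ 0 := fun v hv h0 =>
    mul_ne_zero hA hB (by rw [← ht v hv, h0, zero_mul])
  have htz : t 0 = 0 := by simp [t]
  have hinj : Function.Injective t := by
    intro v v' e
    by_cases hv : v = 0
    · by_contra hne
      exact ht0 v' (fun h => hne (hv.trans h.symm)) (by rw [← e, hv, htz])
    by_cases hv' : v' = 0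
    · exact absurd (by rw [e, hv', htz]) (ht0 v hv)
    -- A root t determines X = t + A + B + AB/t; then v k and hence v are determined, since k ≠ 0.
    have hX : d * v ^ 2 = d * v' ^ 2 := by
      have h1 := ht v hv
      rw [← ht v' hv', e] at h1
      have := mul_left_cancel₀ (ht0 v' hv') h1
      linear_combination this
    have hk0 := (hk (d * v ^ 2) v hv rfl).2
    simp only [t, hv, hv', if_false, ← hX] at e
    have e2 : v * k (d * v ^ 2) = v' * k (d * v ^ 2) := by
      field_simp at e
      linear_combination e
    exact mul_right_cancel₀ hk0 e2
  -- The root -A would force X = -A + A + B - B = 0, although X = d v² with v ≠ 0.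
  obtain ⟨v, hv⟩ := Finite.surjective_of_injective hinj (-A)
  have hv0 : v ≠ 0 := by
    rintro rfl
    rw [htz] at hv
    exact hA (neg_eq_zero.mp hv.symm)
  have h := ht v hv0
  rw [hv] at h
  have : A * (d * v ^ 2) = 0 := by linear_combination -h
  exact mul_ne_zero hA (mul_ne_zero hd (pow_ne_zero 2 hv0)) this

theorem isSquare_mul_of_not_isSquare {ℓ : ℕ} [Fact ℓ.Prime] {x y : ZMod ℓ}
    (hx : ¬ IsSquare x) (hy : ¬ IsSquare y) : IsSquare (x * y) := by
  have hxy : x * y ≠ 0 := mul_ne_zero (by rintro rfl; exact hx (IsSquare.zero))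
    (by rintro rfl; exact hy (IsSquare.zero))
  have h1 := quadraticChar_neg_one_iff_not_isSquare.mpr hx
  have h2 := quadraticChar_neg_one_iff_not_isSquare.mpr hy
  rw [← quadraticChar_one_iff_isSquare hxy, map_mul, h1, h2]; rfl

theorem torsorSolvable_of_good_reduction {ℓ : ℕ} [Fact ℓ.Prime] (hℓ : ℓ ≠ 2) {A B d : ℤ}
    (hA : (A : ZMod ℓ) ≠ 0) (hB : (B : ZMod ℓ) ≠ 0) (hd : (d : ZMod ℓ) ≠ 0) :
    TorsorSolvable ((A : ℚ_[ℓ]) + B) (A * B) d := by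
  by_cases hsq : IsSquare (d : ZMod ℓ)
  · exact Or.inl (isSquare_intCast hℓ hd hsq)
  have h2 : (2 : ZMod ℓ) ≠ 0 := by
    intro h0
    have : ((2 : ℕ) : ZMod ℓ) = 0 := by exact_mod_cast h0
    rw [ZMod.natCast_eq_zero_iff] at this
    exact hℓ ((Nat.prime_dvd_prime_iff_eq Fact.out Nat.prime_two).mp this)
  right
  obtain ⟨v, hv, h | ⟨y, hy, h⟩⟩ := exists_nonsquare_root h2 hA hB hd
    (fun _ _ => isSquare_mul_of_not_isSquare) hsq
  -- The quadratic vanishes modulo ℓ, so Y has residue 0 and cannot be lifted as a unit. Instead the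
  -- square root r of AB is lifted to R, and X = A + B + 2R is an exact root congruent to d v²,
  -- giving a point with Y = 0.
  · set r : ZMod ℓ := (d * v ^ 2 - A - B) / 2 with hr
    have hr2 : r ^ 2 = A * B := by rw [hr]; field_simp; linear_combination h
    have hr0 : r ≠ 0 := fun h0 => mul_ne_zero hA hB (by rw [← hr2, h0]; ring)
    obtain ⟨R, hR, hRr⟩ := isSquare_of_toZMod hℓ (u := ((A * B : ℤ) : ℤ_[ℓ])) hr0
      (by rw [map_intCast, hr2]; push_cast; ring)
    obtain ⟨S, hS, -⟩ := isSquare_of_toZMod hℓ (u := d * (A + B + 2 * R))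
      (v := d * v) (mul_ne_zero hd hv) (by
        simp only [map_mul, map_add, map_intCast, map_ofNat, hRr]
        rw [hr]; field_simp; ring)
    have hS' : (S : ℚ_[ℓ]) ^ 2 = d * (A + B + 2 * R) := by
      exact_mod_cast congrArg (fun z : ℤ_[ℓ] => (z : ℚ_[ℓ])) hS
    have hR' : (R : ℚ_[ℓ]) ^ 2 = A * B := by
      have := congrArg (fun z : ℤ_[ℓ] => (z : ℚ_[ℓ])) hR
      push_cast at this; exact this
    have hd0 : (d : ℚ_[ℓ]) ≠ 0 := by
      intro h0
      have : d = 0 := by exact_mod_cast h0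
      exact hd (by simp [this])
    have hSn : (S : ℚ_[ℓ]) ≠ 0 := by
      intro h0
      have hS0 : S = 0 := Subtype.ext h0
      have hz := congrArg (PadicInt.toZMod (p := ℓ)) hS
      rw [hS0] at hz
      simp only [map_mul, map_add, map_intCast, map_ofNat, hRr, map_pow, map_zero] at hz
      have : (d : ZMod ℓ) * (d * v ^ 2) = 0 := by
        rw [hr] at hz; field_simp at hz; linear_combination -hz
      exact mul_ne_zero hd (mul_ne_zero hd (pow_ne_zero 2 hv)) this
    refine ⟨S / d, 0, div_ne_zero hSn hd0, ?_⟩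
    have hX : (d : ℚ_[ℓ]) * (S / d) ^ 2 = A + B + 2 * R := by
      rw [div_pow, hS']; field_simp
    rw [hX]
    linear_combination (-4 * (A + B + 2 * (R : ℚ_[ℓ]))) * hR'
  · obtain ⟨w, rfl⟩ := ZMod.ringHom_surjective (PadicInt.toZMod (p := ℓ)) v
    obtain ⟨Y, hY, -⟩ := isSquare_of_toZMod hℓ
      (u := d * w ^ 2 * ((d * w ^ 2 - A - B) ^ 2 - 4 * (A * B))) hy (by
        simp only [map_mul, map_sub, map_pow, map_intCast, map_ofNat]
        exact h.symm)
    refine ⟨w, Y, ?_, ?_⟩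
    · intro h0
      have : w = 0 := Subtype.ext h0
      exact hv (by rw [this, map_zero])
    · have := congrArg (fun z : ℤ_[ℓ] => (z : ℚ_[ℓ])) hY
      have h4 : ((4 : ℤ_[ℓ]) : ℚ_[ℓ]) = 4 := rfl
      push_cast at this
      rw [this, h4]; ring

end GoodReduction
/-! ### Independence of primes modulo squares -/

section Independence

instance sqClassModule (k : Type*) [Field k] : Module (ZMod 2) (SqClass k) :=
  AddCommGroup.zmodModule fun x : SqClass k => by
    obtain ⟨u, hu⟩ := QuotientGroup.mk_surjective (Additive.toMul x)
    obtain rfl : x = Additive.ofMul (QuotientGroup.mk u) := congrArg Additive.ofMul hu.symm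
    have h : (QuotientGroup.mk (u ^ 2) : kˣ ⧸ (powMonoidHom 2 : kˣ →* kˣ).range) = 1 :=
      (QuotientGroup.eq_one_iff (u ^ 2)).mpr ⟨u, rfl⟩
    exact congrArg Additive.ofMul h

/-- The class of a nonzero natural number in `ℚˣ / (ℚˣ)²`. -/
def natClass (t : ℕ) : SqClass ℚ :=
  if h : (t : ℚ) ≠ 0 then Additive.ofMul (QuotientGroup.mk (Units.mk0 (t : ℚ) h)) else 0

theorem natClass_eq {t : ℕ} {u : ℚˣ} (h : (u : ℚ) = t) :
    natClass t = Additive.ofMul (QuotientGroup.mk u) := by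
  have h0 : (t : ℚ) ≠ 0 := h ▸ u.ne_zero
  rw [natClass, dif_pos h0]
  congr 2
  exact Units.ext h.symm

/-- The `t`-adic valuation modulo 2. -/
noncomputable def valMod2 (t : ℕ) [Fact t.Prime] : SqClass ℚ →+ ZMod 2 :=
  MonoidHom.toAdditiveLeft (QuotientGroup.lift _
    ({ toFun := fun u => Multiplicative.ofAdd ((padicValRat t (u : ℚ) : ℤ) : ZMod 2)
       map_one' := by simp
       map_mul' := fun u v => by
        rw [Units.val_mul, padicValRat.mul u.ne_zero v.ne_zero, Int.cast_add, ofAdd_add] } :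
      ℚˣ →* Multiplicative (ZMod 2)) (by
    rintro _ ⟨u, rfl⟩
    rw [powMonoidHom_apply, MonoidHom.mem_ker, map_pow]
    exact congrArg Multiplicative.ofAdd (by
      simpa using ZModModule.char_nsmul_eq_zero 2 ((padicValRat t (u : ℚ) : ℤ) : ZMod 2))))

theorem valMod2_natClass (t s : ℕ) [Fact t.Prime] (hs : s.Prime) :
    valMod2 t (natClass s) = if t = s then 1 else 0 := by
  have hs0 : (s : ℚ) ≠ 0 := by exact_mod_cast hs.ne_zero
  have : valMod2 t (natClass s) = ((padicValRat t (s : ℚ) : ℤ) : ZMod 2) := by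
    rw [natClass_eq (u := Units.mk0 (s : ℚ) hs0) rfl]; rfl
  rw [this, padicValRat.of_nat]
  split_ifs with h
  · subst h
    simp
  · have := Fact.mk hs
    rw [padicValNat_primes h]
    simp

/-- The valuations modulo 2 at the primes of T send these classes to the standard basis. -/
theorem linearIndependent_natClass (T : Finset ℕ) (hT : ∀ t ∈ T, t.Prime) :
    LinearIndependent (ZMod 2) (fun t : T => natClass t) := by
  classical
  let Φ : SqClass ℚ →ₗ[ZMod 2] (T → ZMod 2) :=
    LinearMap.pi fun t => haveI : Fact (t : ℕ).Prime := ⟨hT t t.2⟩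
      (valMod2 (t : ℕ)).toZModLinearMap 2
  refine LinearIndependent.of_comp Φ ?_
  have : (Φ ∘ fun t : T => natClass t) = fun t => Pi.single t 1 := by
    funext s t
    have : Fact (t : ℕ).Prime := ⟨hT t t.2⟩
    change valMod2 (t : ℕ) (natClass s) = _
    rw [valMod2_natClass _ _ (hT s s.2), Pi.single_apply]
    simp only [Subtype.ext_iff]
  rw [this]
  exact Pi.linearIndependent_single_one T (ZMod 2)

theorem spanSq_eq_span (T : Finset ℕ) (hT : ∀ t ∈ T, t.Prime) :
    spanSq T = (Submodule.span (ZMod 2) (Set.range fun t : T => natClass t)).toAddSubgroup := by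
  apply le_antisymm
  · refine (AddSubgroup.closure_le _).mpr ?_
    rintro _ ⟨u, ⟨t, ht, hu⟩, rfl⟩
    exact Submodule.subset_span ⟨⟨t, ht⟩, natClass_eq hu⟩
  · change Submodule.span (ZMod 2) _ ≤ AddSubgroup.toZModSubmodule 2 (spanSq T)
    refine Submodule.span_le.mpr ?_
    rintro _ ⟨t, rfl⟩
    have h0 : ((t : ℕ) : ℚ) ≠ 0 := by exact_mod_cast (hT t t.2).ne_zero
    exact AddSubgroup.subset_closure
      ⟨Units.mk0 _ h0, ⟨t, t.2, rfl⟩, natClass_eq (u := Units.mk0 _ h0) rfl⟩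

theorem nonempty_spanSq_addEquiv (T : Finset ℕ) (hT : ∀ t ∈ T, t.Prime) :
    Nonempty (spanSq T ≃+ (Fin T.card → ZMod 2)) := by
  rw [spanSq_eq_span T hT]
  let e := (Module.Basis.span (linearIndependent_natClass T hT)).equivFun.trans
    (LinearEquiv.funCongrLeft (ZMod 2) (ZMod 2) T.equivFin.symm)
  exact ⟨e.toAddEquiv⟩

end Independence

/-! ### The Kummer map -/

section Kummer

variable {k : Type*} [Field k] [CharZero k] (a : k) {b : k}

theorem kummer_mk (hb : b ≠ 0) (u : kˣ) :
    kummer a hb (Additive.ofMul (QuotientGroup.mk u)) =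
      QuotientAddGroup.mk ⟨signFun a hb (sqrtU u), signFun_mem a hb (sqrtU_ne_zero u) (sqrtU_sq u)⟩ :=
  rfl

/-- Galois acts trivially on E[φ], so coboundaries vanish. A class in the kernel therefore has its
square root fixed by the whole Galois group, hence in k. -/
theorem kummer_injective (hb : b ≠ 0) : Function.Injective (kummer a hb) := by
  rw [injective_iff_map_eq_zero]
  intro x hx
  obtain ⟨u, hu⟩ := QuotientGroup.mk_surjective (Additive.toMul x)
  obtain rfl : x = Additive.ofMul (QuotientGroup.mk u) := congrArg Additive.ofMul hu.symm
  rw [kummer_mk, QuotientAddGroup.eq_zero_iff] at hx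
  obtain ⟨m, hm⟩ := hx
  have hfix : ∀ σ : AbsGal k, σ (sqrtU u) = sqrtU u := by
    intro σ
    by_contra hne
    have h1 := hm σ
    rw [galKer_apply, sub_self] at h1
    have h2 := (signFun_of_not_fixed a b hb hne).symm.trans h1
    exact WeierstrassCurve.Affine.Point.some_ne_zero _ (congrArg Subtype.val h2)
  have hmem : sqrtU u ∈ (⊥ : IntermediateField k (AlgebraicClosure k)) := by
    rw [InfiniteGalois.mem_bot_iff_fixed]
    exact hfix
  obtain ⟨s, hs⟩ := IntermediateField.mem_bot.mp hmem
  have hs2 : s ^ 2 = u := by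
    apply (algebraMap k (AlgebraicClosure k)).injective
    rw [map_pow, hs, sqrtU_sq]
  have hs0 : s ≠ 0 := by
    rintro rfl
    exact u.ne_zero (by rw [← hs2]; simp)
  exact congrArg Additive.ofMul ((QuotientGroup.eq_one_iff u).mpr
    ⟨Units.mk0 s hs0, Units.ext hs2⟩)

end Kummer

theorem kummer_mem_selmer (a : ℚ) {b : ℚ} (hb : b ≠ 0) (u : ℚˣ) (hu : 0 < (u : ℚ))
    (h : ∀ (ℓ : ℕ) [Fact ℓ.Prime], TorsorSolvable (a : ℚ_[ℓ]) b (u : ℚ)) :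
    kummer a hb (Additive.ofMul (QuotientGroup.mk u)) ∈ selmer a b := by
  rw [kummer_mk, mk_mem_selmer_iff]
  refine ⟨fun ℓ _ => signFun_mem_locallyTrivial a b hb u (by simpa using h ℓ),
    signFun_mem_locallyTrivial a b hb u (Or.inl ?_)⟩
  have : (0 : ℝ) ≤ (u : ℚ) := by exact_mod_cast hu.le
  exact ⟨√((u : ℚ) : ℝ), by simp [Real.mul_self_sqrt this]⟩

/-! ### Solvability at 2 -/

section Dyadic

/-- The substitution X = D x removes the twist. The quadratic factor is written with Q - P isolated,
since Q - P = 2^m is 2-adically small. -/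
theorem torsorSolvable_of_twist {K : Type*} [Field K] {P Q D d x s w : K} (hs : s ≠ 0)
    (h1 : D * x = d * s ^ 2) (h2 : (x - (Q - P)) ^ 2 - 4 * P * x = d * w ^ 2) :
    TorsorSolvable ((P + Q) * D) (P * Q * D ^ 2) d := by
  refine Or.inr ⟨s, d * s * D * w, hs, ?_⟩
  rw [← h1]
  linear_combination (-d * s ^ 2 * D ^ 2) * h2 - D ^ 2 * (x ^ 2 - 2 * (P + Q) * x + (Q - P) ^ 2) * h1

theorem zmod8_of_odd {n : ℕ} (h : n % 2 = 1) : (n : ZMod 8) * n = 1 := by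
  have key : ∀ z : ZMod 8, z.val % 2 = 1 → z * z = 1 := by decide
  apply key
  rw [ZMod.val_natCast]
  omega

theorem zmod8_of_mod_four {n : ℕ} (h : n % 4 = 3) : (n : ZMod 8) = 3 ∨ (n : ZMod 8) = 7 := by
  have key : ∀ z : ZMod 8, z.val % 4 = 3 → z = 3 ∨ z = 7 := by decide
  apply key
  rw [ZMod.val_natCast]
  omega

theorem zmod8_eq {n r : ℕ} (h : n % 8 = r) : (n : ZMod 8) = r := by
  rw [← h, ZMod.natCast_mod]

variable {p D d m : ℕ}

theorem natCast_ne_zero_of_odd {n : ℕ} (h : n % 2 = 1) : (n : ℚ_[2]) ≠ 0 := by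
  have : n ≠ 0 := by omega
  exact_mod_cast this

/-- If d ≡ 1 (mod 8) it is a square. If d ≡ 5 (mod 8), x = dD works: d times the quadratic factor is
≡ 5(1 - 4) ≡ 1 (mod 8). -/
theorem torsorSolvable_two_of_mod_four_eq_one (hD : D % 2 = 1)
    (hd : d % 4 = 1) (hm : 2 ≤ m) (hp : p % 2 = 1) :
    TorsorSolvable (((p : ℚ_[2]) + (p + 2 ^ m)) * D) (p * (p + 2 ^ m) * D ^ 2) d := by
  have h8 : d % 8 = 1 ∨ d % 8 = 5 := by omega
  rcases h8 with h8 | h8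
  · refine Or.inl ?_
    have := isSquare_intCast_two (u := d) (by simpa using zmod8_eq h8)
    simpa using this
  · have hD0 := natCast_ne_zero_of_odd hD
    have hd0 : (d : ℚ_[2]) ≠ 0 := natCast_ne_zero_of_odd (by omega)
    obtain ⟨k, rfl⟩ : ∃ k, m = k + 2 := ⟨m - 2, by omega⟩
    have hsq : IsSquare (((d * ((d * D - 2 ^ (k + 2)) ^ 2 - 4 * p * (d * D)) : ℤ)) : ℚ_[2]) := by
      apply isSquare_intCast_two
      have e1 := zmod8_eq h8
      have e2 := zmod8_of_odd hD
      have e3 := zmod8_of_odd hp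
      have key : ∀ D p M : ZMod 8, D * D = 1 → p * p = 1 →
          5 * ((5 * D - M * 4) ^ 2 - 4 * p * (5 * D)) = 1 := by decide
      have := key D p (2 ^ k) e2 e3
      push_cast
      rw [e1, pow_add]
      norm_num at this ⊢
      exact this
    obtain ⟨v, hv⟩ := hsq
    push_cast at hv
    refine torsorSolvable_of_twist (K := ℚ_[2]) (D := D) (d := d) (x := (d * D : ℚ_[2])) (s := D) (w := v / d) hD0 (by ring) ?_
    field_simp
    linear_combination hv

/-- With x = 4dD and Q - P = 4, a factor 16 splits off the quadratic, and the congruence makes d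
times the remainder ≡ 1 (mod 8). -/
theorem torsorSolvable_two_of_eq_two (hD : D % 2 = 1)
    (hd : d % 4 = 3) (hpD : (p : ℤ) - D ≡ 2 [ZMOD 8]) :
    TorsorSolvable (K := ℚ_[2]) (((p : ℚ_[2]) + (p + 2 ^ 2)) * D) (p * (p + 2 ^ 2) * D ^ 2) d := by
  have hD0 := natCast_ne_zero_of_odd hD
  have hd0 : (d : ℚ_[2]) ≠ 0 := natCast_ne_zero_of_odd (by omega)
  have hsq : IsSquare (((d * ((d * D - 1) ^ 2 - p * (d * D)) : ℤ)) : ℚ_[2]) := by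
    apply isSquare_intCast_two
    have e1 := zmod8_of_mod_four hd
    have e2 := zmod8_of_odd hD
    have e3 : (p : ZMod 8) - D = 2 := by
      have := (ZMod.intCast_eq_intCast_iff _ _ 8).mpr hpD
      exact_mod_cast this
    have key : ∀ d D p : ZMod 8, d = 3 ∨ d = 7 → D * D = 1 → p - D = 2 →
        d * ((d * D - 1) ^ 2 - p * (d * D)) = 1 := by decide
    push_cast
    exact key d D p e1 e2 e3
  obtain ⟨v, hv⟩ := hsq
  push_cast at hv
  refine torsorSolvable_of_twist (K := ℚ_[2]) (D := D) (d := d) (x := (4 * (d * D) : ℚ_[2])) (s := 2 * D) (w := 4 * (v / d))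
    (mul_ne_zero two_ne_zero hD0) (by ring) ?_
  field_simp
  linear_combination 16 * hv

/-- The unit root satisfies t = B - c/t, and -c/t ≡ c (mod 8) because 4 divides c and t is odd. -/
theorem exists_dyadic_root {B c : ℤ_[2]} (hB : PadicInt.toZModPow 3 B * PadicInt.toZModPow 3 B = 1)
    (hc : PadicInt.toZModPow 3 c = 0 ∨ PadicInt.toZModPow 3 c = 4) (hc2 : ‖c‖ < 1) (hB1 : ‖B‖ = 1) :
    ∃ t : ℤ_[2], t ^ 2 - B * t + c = 0 ∧
      PadicInt.toZModPow 3 t = PadicInt.toZModPow 3 B + PadicInt.toZModPow 3 c := by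
  have e1 : (Polynomial.X ^ 2 - Polynomial.C B * Polynomial.X + Polynomial.C c :
      Polynomial ℤ_[2]).aeval B = c := by
    simp; ring
  have e2 : (Polynomial.X ^ 2 - Polynomial.C B * Polynomial.X + Polynomial.C c :
      Polynomial ℤ_[2]).derivative.aeval B = B := by
    simp; ring
  obtain ⟨t, ht, ht1, -⟩ := hensels_lemma
    (F := (Polynomial.X ^ 2 - Polynomial.C B * Polynomial.X + Polynomial.C c : Polynomial ℤ_[2]))
    (a := B) (by rw [e1, e2, hB1]; simpa using hc2)
  rw [e2, hB1] at ht1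
  have ht2 : t ^ 2 - B * t + c = 0 := by simpa using ht
  refine ⟨t, ht2, ?_⟩
  obtain ⟨y, hy⟩ := PadicInt.norm_lt_one_iff_dvd (t - B) |>.mp ht1
  have ht3 : t = B + 2 * y := by
    have : ((2 : ℕ) : ℤ_[2]) = 2 := by norm_num
    rw [this] at hy
    linear_combination hy
  have h := congrArg (PadicInt.toZModPow (p := 2) 3) ht2
  rw [ht3] at h ⊢
  simp only [map_add, map_sub, map_mul, map_pow, map_zero, map_ofNat] at h ⊢
  have key : ∀ B c y : ZMod 8, B * B = 1 → (c = 0 ∨ c = 4) →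
      (B + 2 * y) ^ 2 - B * (B + 2 * y) + c = 0 → B + 2 * y = B + c := by decide
  exact key _ _ _ hB hc h

/-- With x = 4t and m = k + 3, the quadratic factor is required to equal 16 e² D t. This makes t a
root of t² - (p + 4·2^k + e² D) t + 4·4^k, and both conditions of `torsorSolvable_of_twist` then
reduce to t d D being a square. -/
theorem torsorSolvable_two_of_three_le (hD : D % 2 = 1)
    (hd : d % 4 = 3) (hm : 3 ≤ m) (hp : p % 2 = 1) (hpD : (p : ℤ) + D ≡ 0 [ZMOD 4]) :
    TorsorSolvable (((p : ℚ_[2]) + (p + 2 ^ m)) * D) (p * (p + 2 ^ m) * D ^ 2) d := by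
  have hD0 := natCast_ne_zero_of_odd hD
  have hd0 : (d : ℚ_[2]) ≠ 0 := natCast_ne_zero_of_odd (by omega)
  obtain ⟨k, rfl⟩ : ∃ k, m = k + 3 := ⟨m - 3, by omega⟩
  have e1 := zmod8_of_mod_four hd
  have e2 := zmod8_of_odd hD
  have e3 := zmod8_of_odd hp
  have e4 : (p : ZMod 8) + D = 0 ∨ (p : ZMod 8) + D = 4 := by
    have h : (p + D) % 8 = 0 ∨ (p + D) % 8 = 4 := by
      unfold Int.ModEq at hpD
      omega
    rcases h with h | h
    · left; exact_mod_cast zmod8_eq h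
    · right; exact_mod_cast zmod8_eq h
  -- Here p d D is 1 or 5 modulo 8. Taking e = 4 leaves it unchanged, while e = 2 adds 4.
  obtain ⟨e, he⟩ : ∃ e : ℕ, ((e : ZMod 8) ^ 2 * D = 0 ∨ (e : ZMod 8) ^ 2 * D = 4) ∧ e ≠ 0 ∧ e % 2 = 0 ∧
      ((p : ZMod 8) + e ^ 2 * D) * d * D = 1 := by
    have key : ∀ d D p : ZMod 8, d = 3 ∨ d = 7 → D * D = 1 → (p + D = 0 ∨ p + D = 4) →
        (((2 ^ 2 * D = 0 ∨ 2 ^ 2 * D = 4) ∧ (p + 2 ^ 2 * D) * d * D = 1) ∨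
        ((4 ^ 2 * D = 0 ∨ 4 ^ 2 * D = 4) ∧ (p + 4 ^ 2 * D) * d * D = 1)) := by decide
    rcases key d D p e1 e2 e4 with h | h
    · exact ⟨2, by exact_mod_cast h.1, by norm_num, by norm_num, by exact_mod_cast h.2⟩
    · exact ⟨4, by exact_mod_cast h.1, by norm_num, by norm_num, by exact_mod_cast h.2⟩
  obtain ⟨he1, he0, hee, he2⟩ := he
  -- The contributions 4·2^k from the linear coefficient and 4·4^k from the constant term cancel
  -- modulo 8, so t ≡ p + e² D.
  have hcM : ((4 * 2 ^ k : ℕ) : ZMod 8) = ((4 * 4 ^ k : ℕ) : ZMod 8) ∧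
      (((4 * 4 ^ k : ℕ) : ZMod 8) = 0 ∨ ((4 * 4 ^ k : ℕ) : ZMod 8) = 4) := by
    rcases k with _ | k
    · exact ⟨rfl, Or.inr rfl⟩
    · have h1 : ((4 * 2 ^ (k + 1) : ℕ) : ZMod 8) = 0 :=
        (ZMod.natCast_eq_zero_iff _ _).mpr ⟨2 ^ k, by ring⟩
      have h2 : ((4 * 4 ^ (k + 1) : ℕ) : ZMod 8) = 0 :=
        (ZMod.natCast_eq_zero_iff _ _).mpr ⟨2 * 4 ^ k, by ring⟩
      exact ⟨h1.trans h2.symm, Or.inl h2⟩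
  obtain ⟨t, ht, htB⟩ := exists_dyadic_root (B := ((p + 4 * 2 ^ k + e ^ 2 * D : ℕ) : ℤ_[2]))
    (c := ((4 * 4 ^ k : ℕ) : ℤ_[2])) (by
      rw [map_natCast]
      refine zmod8_of_odd ?_
      have : e ^ 2 % 2 = 0 := by rw [Nat.pow_mod, hee]
      have : e ^ 2 * D % 2 = 0 := by rw [Nat.mul_mod, this]; simp
      omega) (by rw [map_natCast]; exact hcM.2) (by
      have := (PadicInt.norm_natCast_lt_one_iff (p := 2) (n := 4 * 4 ^ k)).mpr ⟨2 * 4 ^ k, by ring⟩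
      exact this) (by
      rw [PadicInt.norm_natCast_eq_one_iff, Nat.coprime_two_left, Nat.odd_iff]
      have : e ^ 2 % 2 = 0 := by rw [Nat.pow_mod, hee]
      have : e ^ 2 * D % 2 = 0 := by rw [Nat.mul_mod, this]; simp
      omega)
  obtain ⟨r, hr⟩ := exists_sq_eq_of_toZModPow_three (u := t * d * D) (by
    rw [map_mul, map_mul, htB]
    simp only [map_natCast]
    have h1 : ((p + 4 * 2 ^ k + e ^ 2 * D : ℕ) : ZMod 8) + ((4 * 4 ^ k : ℕ) : ZMod 8) =
        (p : ZMod 8) + e ^ 2 * D := by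
      rw [Nat.cast_add, Nat.cast_add, hcM.1]
      push_cast
      have : (8 : ZMod 8) = 0 := rfl
      linear_combination (4 : ZMod 8) ^ k * this
    exact (congrArg (fun z : ZMod 8 => z * d * D) h1).trans he2)
  have hr' : (r : ℚ_[2]) ^ 2 = t * d * D := by
    have := congrArg (fun z : ℤ_[2] => (z : ℚ_[2])) hr
    push_cast at this
    exact this
  have ht' : (t : ℚ_[2]) ^ 2 - (p + 4 * 2 ^ k + e ^ 2 * D) * t + 4 * 4 ^ k = 0 := by
    have := congrArg (fun z : ℤ_[2] => (z : ℚ_[2])) ht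
    have h2 : ((2 : ℤ_[2]) : ℚ_[2]) = 2 := rfl
    have h4 : ((4 : ℤ_[2]) : ℚ_[2]) = 4 := rfl
    push_cast [h2, h4] at this
    exact this
  have ht0 : (t : ℚ_[2]) ≠ 0 := by
    intro h0
    rw [h0] at ht'
    have : (4 : ℚ_[2]) * 4 ^ k = 0 := by linear_combination ht'
    exact absurd this (mul_ne_zero (by norm_num) (pow_ne_zero _ (by norm_num)))
  have hr0 : (r : ℚ_[2]) ≠ 0 := by
    intro h0
    rw [h0] at hr'
    exact mul_ne_zero (mul_ne_zero ht0 hd0) hD0 (by rw [← hr']; ring)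
  refine torsorSolvable_of_twist (K := ℚ_[2]) (D := D) (d := d) (x := (4 * t : ℚ_[2])) (s := 2 * r / d) (w := 4 * (e * r / d))
    (div_ne_zero (mul_ne_zero two_ne_zero hr0) hd0) ?_ ?_
  · field_simp
    linear_combination (-4) * hr'
  · have h4 : (4 : ℚ_[2]) ^ k = (2 ^ k) ^ 2 := by
      rw [← pow_mul, mul_comm, pow_mul]; norm_num
    rw [h4] at ht'
    field_simp
    rw [pow_add]
    linear_combination (-16 * (e : ℚ_[2]) ^ 2) * hr' + 16 * d * ht'

theorem torsorSolvable_two_two (hD : D % 2 = 1)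
    (hpD : (p * D) % 8 = 1 ∨ (p * D) % 8 = 7)
    (h : (m = 3 ∧ (p * D) % 8 = 7) ∨ (m = 4 ∧ (p * D) % 8 = 1) ∨ 5 ≤ m) :
    TorsorSolvable (((p : ℚ_[2]) + (p + 2 ^ m)) * D) (p * (p + 2 ^ m) * D ^ 2) 2 := by
  have hD0 := natCast_ne_zero_of_odd hD
  have e2 := zmod8_of_odd hD
  -- The case m ≥ 5 splits by pD modulo 8. The residue 1 joins m = 4, with x = 8D; the residue 7
  -- needs x = 32D.
  have hcase : (m = 3 ∧ (p * D) % 8 = 7) ∨ (∃ k, m = k + 4 ∧ (p * D) % 8 = 1) ∨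
      ∃ k, m = k + 5 ∧ (p * D) % 8 = 7 := by
    rcases h with h | ⟨h, h'⟩ | h
    · exact Or.inl h
    · exact Or.inr (Or.inl ⟨0, h, h'⟩)
    · rcases hpD with h' | h'
      · exact Or.inr (Or.inl ⟨m - 4, by omega, h'⟩)
      · exact Or.inr (Or.inr ⟨m - 5, by omega, h'⟩)
  clear h
  rcases hcase with ⟨rfl, h⟩ | ⟨k, rfl, h⟩ | ⟨k, rfl, h⟩
  · have hsq : IsSquare (((2 * (D - 1) ^ 2 - p * D : ℤ)) : ℚ_[2]) := by
      apply isSquare_intCast_two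
      have e1 : (p : ZMod 8) * D = 7 := by exact_mod_cast zmod8_eq h
      have key : ∀ D : ZMod 8, D * D = 1 → 2 * (D - 1) ^ 2 - 7 = 1 := by decide
      push_cast
      rw [e1]
      exact key D e2
    obtain ⟨v, hv⟩ := hsq
    push_cast at hv
    refine torsorSolvable_of_twist (K := ℚ_[2]) (D := D) (d := 2) (x := (8 * D : ℚ_[2])) (s := 2 * D) (w := 4 * v)
      (mul_ne_zero two_ne_zero hD0) (by ring) ?_
    linear_combination 32 * hv
  · have hsq : IsSquare (((2 * (D - 2 * 2 ^ k) ^ 2 - p * D : ℤ)) : ℚ_[2]) := by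
      apply isSquare_intCast_two
      have e1 : (p : ZMod 8) * D = 1 := by exact_mod_cast zmod8_eq h
      have key : ∀ D M : ZMod 8, D * D = 1 → 2 * (D - 2 * M) ^ 2 - 1 = 1 := by decide
      push_cast
      rw [e1]
      exact key D (2 ^ k) e2
    obtain ⟨v, hv⟩ := hsq
    push_cast at hv
    refine torsorSolvable_of_twist (K := ℚ_[2]) (D := D) (d := 2) (x := (8 * D : ℚ_[2])) (s := 2 * D) (w := 4 * v)
      (mul_ne_zero two_ne_zero hD0) (by ring) ?_
    rw [pow_add]
    linear_combination 32 * hv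
  · have hsq : IsSquare (((8 * (D - 2 ^ k) ^ 2 - p * D : ℤ)) : ℚ_[2]) := by
      apply isSquare_intCast_two
      have e1 : (p : ZMod 8) * D = 7 := by exact_mod_cast zmod8_eq h
      have key : ∀ D M : ZMod 8, 8 * (D - M) ^ 2 - 7 = 1 := by decide
      push_cast
      rw [e1]
      exact key D (2 ^ k)
    obtain ⟨v, hv⟩ := hsq
    push_cast at hv
    refine torsorSolvable_of_twist (K := ℚ_[2]) (D := D) (d := 2) (x := (32 * D : ℚ_[2])) (s := 4 * D) (w := 8 * v)
      (mul_ne_zero (by norm_num) hD0) (by ring) ?_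
    rw [pow_add]
    linear_combination 128 * hv

end Dyadic
/-! ### Local conditions for the family -/

section FamilyLocal

open scoped NumberTheorySymbols

theorem jacobiSym_eq_one_or_neg_one {a : ℤ} {l : ℕ} (hl : l.Prime) (h : ¬ (l : ℤ) ∣ a) :
    J(a | l) = 1 ∨ J(a | l) = -1 := by
  refine jacobiSym.eq_one_or_neg_one ?_
  exact Int.isCoprime_iff_gcd_eq_one.mp
    ((Prime.coprime_iff_not_dvd (Nat.prime_iff_prime_int.mp hl)).mpr h).symm

theorem intCast_zmod_ne_zero {a : ℤ} {l : ℕ} (h : ¬ (l : ℤ) ∣ a) : (a : ZMod l) ≠ 0 :=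
  fun h0 => h ((ZMod.intCast_zmod_eq_zero_iff_dvd a l).mp h0)

theorem isSquare_padic_of_jacobiSym {a : ℤ} {l : ℕ} [Fact l.Prime] (hl : l ≠ 2)
    (h : ¬ (l : ℤ) ∣ a) (hJ : J(a | l) = 1) : IsSquare (a : ℚ_[l]) :=
  isSquare_intCast hl (intCast_zmod_ne_zero h) (ZMod.isSquare_of_jacobiSym_eq_one hJ)

theorem not_dvd_of_prime_ne {l r : ℕ} (hl : l.Prime) (hr : r.Prime) (h : l ≠ r) :
    ¬ (l : ℤ) ∣ r := fun hd =>
  h ((Nat.prime_dvd_prime_iff_eq hl hr).mp (by exact_mod_cast hd))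

/-- If `q ≡ p (mod 4)` and `l` is a square modulo `p` and `q`, then `(p / l) = (q / l)`. -/
theorem jacobiSym_eq_of_reciprocity {p q l : ℕ} (hp : Odd p) (hq : Odd q) (hl : Odd l)
    (hpq : q % 4 = p % 4) (h1 : J(l | p) = 1) (h2 : J(l | q) = 1) : J(p | l) = J(q | l) := by
  rw [jacobiSym.quadratic_reciprocity hp hl, jacobiSym.quadratic_reciprocity hq hl, h1, h2]
  have : q / 2 % 2 = p / 2 % 2 := by omega
  congr 1
  rw [pow_mul, pow_mul]
  congr 1
  rw [neg_one_pow_eq_pow_mod_two (n := p / 2), neg_one_pow_eq_pow_mod_two (n := q / 2), this]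

/-- At a prime `d` dividing `D = d e` where `p q` and `p e` are squares, a root of
`X² - 2 (p + q) D X + (p - q)² D²` has the class of `d`. -/
theorem torsorSolvable_of_isSquare {K : Type*} [Field K] {p q d e : K} (hp : p ≠ 0)
    (hpq : p ≠ q) (he : e ≠ 0) (h1 : IsSquare (p * q)) (h2 : IsSquare (p * e)) :
    TorsorSolvable ((p + q) * (d * e)) (p * q * (d * e) ^ 2) d := by
  obtain ⟨r, hr⟩ := h1
  obtain ⟨s, hs⟩ := h2
  have hs0 : s ≠ 0 := by rintro rfl; exact mul_ne_zero hp he (by simpa using hs)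
  have hpr : p + r ≠ 0 := by
    intro h
    apply hpq
    have h3 : r = -p := by linear_combination h
    rw [h3] at hr
    exact mul_left_cancel₀ hp (by linear_combination -hr)
  -- With r² = pq, the root is de(p + q + 2r) = de(p + r)²/p, and e/p = (s/p)².
  refine Or.inr ⟨s * (p + r) / p, 0, div_ne_zero (mul_ne_zero hs0 hpr) hp, ?_⟩
  have hX : d * (s * (p + r) / p) ^ 2 = d * e * (p + q + 2 * r) := by
    field_simp
    linear_combination (-d * (p + r) ^ 2) * hs - d * p * e * hr
  rw [hX]
  linear_combination (4 * (d * e) ^ 3 * (p + q + 2 * r)) * hr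

variable {p q : ℕ} {n : ℕ} {D : Fin n → ℕ} {m : ℕ}

theorem bigD_eq (i : Fin n) : bigD D = D i * hatD D i :=
  (Finset.mul_prod_erase _ _ (Finset.mem_univ i)).symm

theorem bigD_odd (hD : ∀ i, (D i).Prime) (hD2 : ∀ i, D i ≠ 2) : Odd (bigD D) := by
  unfold bigD
  exact Finset.prod_induction _ Odd (fun _ _ => Odd.mul) odd_one
    fun i _ => (hD i).odd_of_ne_two (hD2 i)

theorem not_dvd_hatD (hD : ∀ i, (D i).Prime) (hinj : Function.Injective D) (i : Fin n) :
    ¬ D i ∣ hatD D i := by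
  intro h
  obtain ⟨j, hj, hij⟩ := (Prime.dvd_finsetProd_iff (hD i).prime _).mp h
  exact (Finset.mem_erase.mp hj).1
    (hinj ((Nat.prime_dvd_prime_iff_eq (hD i) (hD j)).mp hij)).symm

theorem jacobiSym_le_one (a : ℤ) (b : ℕ) : J(a | b) ≤ 1 := by
  rcases jacobiSym.trichotomy a b with h | h | h <;> rw [h] <;> norm_num

theorem delta_nonneg (i : Fin n) : 0 ≤ delta p D m i := by
  unfold delta; split_ifs <;> norm_num

theorem deltaLast_nonneg : 0 ≤ deltaLast p D m := by
  unfold deltaLast; split_ifs <;> norm_num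

theorem sum_one_sub_jacobiSym_nonneg (s : Finset ℕ) (a : ℤ) : 0 ≤ ∑ l ∈ s, (1 - J(a | l)) :=
  Finset.sum_nonneg fun l _ => sub_nonneg.mpr (jacobiSym_le_one a l)

theorem bigPi_nonneg (i : Fin n) : 0 ≤ bigPi p q D m i :=
  add_nonneg (add_nonneg (delta_nonneg i) (mul_nonneg (sub_nonneg.mpr (jacobiSym_le_one _ _))
    (sub_nonneg.mpr (jacobiSym_le_one _ _)))) (sum_one_sub_jacobiSym_nonneg _ _)

theorem bigPiLast_nonneg : 0 ≤ bigPiLast p q D m :=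
  add_nonneg deltaLast_nonneg (sum_one_sub_jacobiSym_nonneg _ _)

theorem jacobiSym_eq_one_of_sum_eq_zero {s : Finset ℕ} {a : ℤ} (h : ∑ l ∈ s, (1 - J(a | l)) = 0)
    {l : ℕ} (hl : l ∈ s) : J(a | l) = 1 := by
  have := (Finset.sum_eq_zero_iff_of_nonneg
    (fun l _ => sub_nonneg.mpr (jacobiSym_le_one a l))).mp h l hl
  omega

theorem bigPi_eq_zero {i : Fin n} (h : bigPi p q D m i = 0) :
    delta p D m i = 0 ∧
      (J((q * hatD D i : ℕ) | D i) = 1 ∨ J((p * hatD D i : ℕ) | D i) = 1) ∧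
      ∀ l ∈ (p * q * hatD D i).primeFactors, J(D i | l) = 1 := by
  have h1 := delta_nonneg (p := p) (D := D) (m := m) i
  have h2 : 0 ≤ (1 - J((q * hatD D i : ℕ) | D i)) * (1 - J((p * hatD D i : ℕ) | D i)) :=
    mul_nonneg (sub_nonneg.mpr (jacobiSym_le_one _ _)) (sub_nonneg.mpr (jacobiSym_le_one _ _))
  have h3 := sum_one_sub_jacobiSym_nonneg (p * q * hatD D i).primeFactors (D i)
  unfold bigPi at h
  refine ⟨by linarith, ?_, fun l hl => jacobiSym_eq_one_of_sum_eq_zero (by linarith) hl⟩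
  have h4 : (1 - J((q * hatD D i : ℕ) | D i)) * (1 - J((p * hatD D i : ℕ) | D i)) = 0 := by
    linarith
  rcases mul_eq_zero.mp h4 with h | h
  · left; linarith
  · right; linarith

theorem bigPiLast_eq_zero (h : bigPiLast p q D m = 0) :
    deltaLast p D m = 0 ∧ ∀ l ∈ (p * q * bigD D).primeFactors, J(2 | l) = 1 := by
  have h1 := deltaLast_nonneg (p := p) (D := D) (m := m)
  have h3 := sum_one_sub_jacobiSym_nonneg (p * q * bigD D).primeFactors 2
  unfold bigPiLast at h
  exact ⟨by linarith, fun l hl => jacobiSym_eq_one_of_sum_eq_zero (by linarith) hl⟩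

theorem torsorSolvable_of_not_dvd {l : ℕ} [Fact l.Prime] (hl : l ≠ 2) {E d : ℕ}
    (hpqE : ¬ l ∣ p * q * E) (hd : ¬ l ∣ d) :
    TorsorSolvable (((p : ℚ_[l]) + q) * E) (p * q * E ^ 2) d := by
  have hA : ¬ (l : ℤ) ∣ ((p * E : ℕ) : ℤ) := fun h =>
    hpqE (((Int.natCast_dvd_natCast.mp h).mul_left q).trans (dvd_of_eq (by ring)))
  have hB : ¬ (l : ℤ) ∣ ((q * E : ℕ) : ℤ) := fun h =>
    hpqE (((Int.natCast_dvd_natCast.mp h).mul_left p).trans (dvd_of_eq (by ring)))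
  have := torsorSolvable_of_good_reduction hl (intCast_zmod_ne_zero hA) (intCast_zmod_ne_zero hB)
    (intCast_zmod_ne_zero (a := (d : ℤ)) (fun h => hd (Int.natCast_dvd_natCast.mp h)))
  push_cast at this
  convert this using 1 <;> ring

theorem torsorSolvable_D (hp : p.Prime) (hp2 : p ≠ 2) (hq : q.Prime) (hq2 : q ≠ 2)
    (hm : 2 ≤ m) (hpq : q = p + 2 ^ m)
    (hD : ∀ i, (D i).Prime) (hinj : Function.Injective D)
    (hD2 : ∀ i, D i ≠ 2) (hDp : ∀ i, D i ≠ p) (hDq : ∀ i, D i ≠ q) {i : Fin n}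
    (h : bigPi p q D m i = 0) (l : ℕ) [Fact l.Prime] :
    TorsorSolvable (((p : ℚ_[l]) + q) * bigD D) (p * q * bigD D ^ 2) (D i : ℕ) := by
  have hl : l.Prime := Fact.out
  obtain ⟨hδ, hloc, hsq⟩ := bigPi_eq_zero h
  have hDodd := (Nat.odd_iff.mp (bigD_odd hD hD2))
  have hpodd := Nat.odd_iff.mp (hp.odd_of_ne_two hp2)
  have hhat : hatD D i ≠ 0 := Finset.prod_ne_zero_iff.mpr fun j _ => (hD j).ne_zero
  have hN : p * q * hatD D i ≠ 0 := mul_ne_zero (mul_ne_zero hp.ne_zero hq.ne_zero) hhat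
  by_cases hl2 : l = 2
  · subst hl2 hpq
    push_cast
    unfold delta at hδ
    split_ifs at hδ with hc
    swap
    · exact absurd hδ one_ne_zero
    have hdodd := Nat.odd_iff.mp ((hD i).odd_of_ne_two (hD2 i))
    by_cases h1 : D i % 4 = 1
    · exact torsorSolvable_two_of_mod_four_eq_one hDodd h1 hm hpodd
    have h3 : D i % 4 = 3 := by omega
    rcases hc with hc | ⟨rfl, hc⟩ | ⟨h3m, hc⟩
    · exact absurd (by unfold Int.ModEq at hc; omega) h1
    · exact torsorSolvable_two_of_eq_two hDodd h3 hc
    · exact torsorSolvable_two_of_three_le hDodd h3 h3m hpodd hc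
  by_cases hli : l = D i
  · subst hli
    have hpD : ¬ ((D i : ℕ) : ℤ) ∣ (p : ℤ) := not_dvd_of_prime_ne (hD i) hp (hDp i)
    have hqD : ¬ ((D i : ℕ) : ℤ) ∣ (q : ℤ) := not_dvd_of_prime_ne (hD i) hq (hDq i)
    have hhD : ¬ ((D i : ℕ) : ℤ) ∣ (hatD D i : ℤ) := fun h =>
      not_dvd_hatD hD hinj i (Int.natCast_dvd_natCast.mp h)
    have hprime := Nat.prime_iff_prime_int.mp (hD i)
    -- The terms l = p and l = q of the sum say that Dᵢ is a square modulo p and q. Once the two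
    -- symbols agree, either factor of the product term may be assumed to vanish.
    have hrec : J(p | D i) = J(q | D i) := by
      refine jacobiSym_eq_of_reciprocity (hp.odd_of_ne_two hp2) (hq.odd_of_ne_two hq2)
        ((hD i).odd_of_ne_two (hD2 i)) ?_ (hsq p ?_) (hsq q ?_)
      · obtain ⟨k, rfl⟩ : ∃ k, m = k + 2 := ⟨m - 2, by omega⟩
        rw [hpq, pow_add]
        omega
      · exact Nat.mem_primeFactors.mpr ⟨hp, ⟨q * hatD D i, by ring⟩, hN⟩
      · exact Nat.mem_primeFactors.mpr ⟨hq, ⟨p * hatD D i, by ring⟩, hN⟩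
    have hpe : J((p : ℤ) * hatD D i | D i) = 1 := by
      push_cast at hloc
      rcases hloc with h | h
      · rw [jacobiSym.mul_left, hrec, ← jacobiSym.mul_left, h]
      · exact h
    have hpq1 : J((p : ℤ) * q | D i) = 1 := by
      rw [jacobiSym.mul_left, ← hrec]
      rcases jacobiSym_eq_one_or_neg_one (hD i) hpD with h | h <;> rw [h] <;> rfl
    have s1 := isSquare_padic_of_jacobiSym hl2
      (fun h => (hprime.dvd_or_dvd h).elim hpD hqD) hpq1
    have s2 := isSquare_padic_of_jacobiSym hl2
      (fun h => (hprime.dvd_or_dvd h).elim hpD hhD) hpe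
    push_cast at s1 s2
    have hne : (p : ℚ_[D i]) ≠ q := by
      intro h
      have h' : p = q := by exact_mod_cast h
      have := Nat.pos_of_ne_zero (pow_ne_zero m two_ne_zero)
      omega
    rw [bigD_eq i]
    push_cast
    exact torsorSolvable_of_isSquare (by exact_mod_cast hp.ne_zero) hne (by exact_mod_cast hhat)
      s1 s2
  have hlD : ¬ l ∣ D i := fun hd => hli ((Nat.prime_dvd_prime_iff_eq hl (hD i)).mp hd)
  by_cases hdiv : l ∣ p * q * hatD D i
  · refine Or.inl ?_
    have := isSquare_padic_of_jacobiSym hl2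
      (fun h => hlD (Int.natCast_dvd_natCast.mp h))
      (hsq l (Nat.mem_primeFactors.mpr ⟨hl, hdiv, hN⟩))
    simpa using this
  · refine torsorSolvable_of_not_dvd hl2 (fun h => ?_) hlD
    rw [bigD_eq i, show p * q * (D i * hatD D i) = D i * (p * q * hatD D i) by ring] at h
    exact (hl.dvd_mul.mp h).elim hlD hdiv

theorem mod_eight_of_jacobiSym_two {l : ℕ} (hl : Odd l) (h : J(2 | l) = 1) :
    l % 8 = 1 ∨ l % 8 = 7 := by
  rw [jacobiSym.at_two hl, ZMod.χ₈_nat_eq_if_mod_eight] at h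
  have := Nat.odd_iff.mp hl
  split_ifs at h <;> omega

theorem mul_mod_eight {a b : ℕ} (ha : a % 8 = 1 ∨ a % 8 = 7) (hb : b % 8 = 1 ∨ b % 8 = 7) :
    a * b % 8 = 1 ∨ a * b % 8 = 7 := by
  rcases ha with ha | ha <;> rcases hb with hb | hb <;> simp [Nat.mul_mod, ha, hb]

theorem torsorSolvable_two (hp : p.Prime) (hp2 : p ≠ 2) (hq : q.Prime)
    (hpq : q = p + 2 ^ m)
    (hD : ∀ i, (D i).Prime) (hD2 : ∀ i, D i ≠ 2)
    (h : bigPiLast p q D m = 0) (l : ℕ) [Fact l.Prime] :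
    TorsorSolvable (((p : ℚ_[l]) + q) * bigD D) (p * q * bigD D ^ 2) 2 := by
  have hl : l.Prime := Fact.out
  obtain ⟨hδ, hsq⟩ := bigPiLast_eq_zero h
  have hDodd := Nat.odd_iff.mp (bigD_odd hD hD2)
  have hD0 : bigD D ≠ 0 := by omega
  have hN : p * q * bigD D ≠ 0 := mul_ne_zero (mul_ne_zero hp.ne_zero hq.ne_zero) hD0
  by_cases hl2 : l = 2
  -- Every prime dividing pD is ±1 modulo 8, since 2 is a square modulo it.
  · have hpD : (p * bigD D) % 8 = 1 ∨ (p * bigD D) % 8 = 7 := by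
      refine mul_mod_eight ?_ ?_
      · exact mod_eight_of_jacobiSym_two (hp.odd_of_ne_two hp2)
          (hsq p (Nat.mem_primeFactors.mpr ⟨hp, ⟨q * bigD D, by ring⟩, hN⟩))
      · refine Finset.prod_induction _ (fun z => z % 8 = 1 ∨ z % 8 = 7)
          (fun _ _ => mul_mod_eight) (Or.inl rfl) fun i _ => ?_
        refine mod_eight_of_jacobiSym_two ((hD i).odd_of_ne_two (hD2 i)) (hsq _ ?_)
        exact Nat.mem_primeFactors.mpr ⟨hD i, ⟨p * q * hatD D i, by rw [bigD_eq i]; ring⟩, hN⟩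
    subst hl2 hpq
    push_cast
    refine torsorSolvable_two_two hDodd hpD ?_
    unfold deltaLast at hδ
    split_ifs at hδ with hc
    swap
    · exact absurd hδ one_ne_zero
    unfold Int.ModEq at hc
    have hcast : (p : ℤ) * bigD D = ((p * bigD D : ℕ) : ℤ) := by push_cast; ring
    rw [hcast] at hc
    omega
  have hl2' : ¬ l ∣ 2 := fun hd => hl2 ((Nat.prime_dvd_prime_iff_eq hl Nat.prime_two).mp hd)
  by_cases hdiv : l ∣ p * q * bigD D
  · refine Or.inl ?_
    have := isSquare_padic_of_jacobiSym hl2 (a := 2)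
      (fun h => hl2' (Int.natCast_dvd_natCast.mp h))
      (hsq l (Nat.mem_primeFactors.mpr ⟨hl, hdiv, hN⟩))
    simpa using this
  · simpa using torsorSolvable_of_not_dvd hl2 hdiv hl2'

/-! ### The set T and its cardinality -/

theorem natFloor_one_div {z : ℤ} (hz : 0 ≤ z) :
    ⌊(1 : ℚ) / (1 + z)⌋₊ = if z = 0 then 1 else 0 := by
  split_ifs with h
  · simp [h]
  · rw [Nat.floor_eq_zero]
    have : (1 : ℚ) ≤ z := by exact_mod_cast (by omega : (1 : ℤ) ≤ z)
    rw [div_lt_one (by linarith)]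
    linarith

open Classical in
/-- The primes `Dᵢ` with `Πᵢ⁺(D) = 0`, together with 2 if `Πₙ₊₁⁺(D) = 0`. -/
noncomputable def selmerPrimes (p q : ℕ) (D : Fin n → ℕ) (m : ℕ) : Finset ℕ :=
  (Finset.univ.filter fun i => bigPi p q D m i = 0).image D ∪
    if bigPiLast p q D m = 0 then {2} else ∅

theorem mem_selmerPrimes {t : ℕ} : t ∈ selmerPrimes p q D m ↔
    (∃ i, bigPi p q D m i = 0 ∧ D i = t) ∨ (bigPiLast p q D m = 0 ∧ t = 2) := by
  unfold selmerPrimes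
  split_ifs with h <;> simp [h, or_comm]

theorem card_selmerPrimes (hinj : Function.Injective D) (hD2 : ∀ i, D i ≠ 2) :
    (selmerPrimes p q D m).card = rho p q D m := by
  classical
  unfold selmerPrimes rho
  rw [Finset.card_union_of_disjoint, Finset.card_image_of_injective _ hinj,
    natFloor_one_div bigPiLast_nonneg]
  · congr 1
    · simp only [natFloor_one_div (bigPi_nonneg _), Finset.card_filter]
    · split_ifs <;> simp
  · split_ifs
    · simp [hD2]
    · simp

end FamilyLocal

/-! ### Assembly of the theorem -/

theorem cardinal_le_rank_of_addEquiv {M : Type} [AddCommGroup M] [Module (ZMod 2) M] {N : ℕ}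
    (f : (Fin N → ZMod 2) →+ M) (hf : Function.Injective f) :
    (N : Cardinal) ≤ Module.rank (ZMod 2) M := by
  have := LinearMap.rank_le_of_injective (f.toZModLinearMap 2) hf
  simpa using this

end TwoIsogenySelmer

open TwoIsogenySelmer in
theorem theoremA1 (p q m n : ℕ) (D : Fin n → ℕ)
    (hp : p.Prime) (hp2 : p ≠ 2) (hq : q.Prime) (hq2 : q ≠ 2)
    (hm : 2 ≤ m) (hpq : q = p + 2 ^ m)
    (hD : ∀ i, (D i).Prime) (hinj : Function.Injective D)
    (hD2 : ∀ i, D i ≠ 2) (hDp : ∀ i, D i ≠ p) (hDq : ∀ i, D i ≠ q) :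
    (∃ T : Finset ℕ, (T : Set ℕ) ⊆ {2} ∪ Set.range D ∧ T.card = rho p q D m ∧
      Nonempty (spanSq T ≃+ (Fin (rho p q D m) → ZMod 2)) ∧
      (spanSq T).map (kummer (coeffA p q D) (coeffB_ne_zero hp hq hD)) ≤
        selmer (coeffA p q D) (coeffB p q D) ∧
      Nonempty ((spanSq T).map (kummer (coeffA p q D) (coeffB_ne_zero hp hq hD)) ≃+
        (Fin (rho p q D m) → ZMod 2))) ∧
    (rho p q D m : Cardinal) ≤
      Module.rank (ZMod 2) (selmer (coeffA p q D) (coeffB p q D)) := by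
  have hcard := card_selmerPrimes (p := p) (q := q) (m := m) hinj hD2
  have hprime : ∀ t ∈ selmerPrimes p q D m, t.Prime := by
    intro t ht
    rcases mem_selmerPrimes.mp ht with ⟨i, -, rfl⟩ | ⟨-, rfl⟩
    exacts [hD i, Nat.prime_two]
  have hle : (spanSq (selmerPrimes p q D m)).map
      (kummer (coeffA p q D) (coeffB_ne_zero hp hq hD)) ≤
        selmer (coeffA p q D) (coeffB p q D) := by
    rw [AddSubgroup.map_le_iff_le_comap, spanSq, AddSubgroup.closure_le]
    rintro _ ⟨u, ⟨t, ht, hu⟩, rfl⟩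
    refine kummer_mem_selmer _ _ u ?_ fun l _ => ?_
    · rw [hu]
      exact_mod_cast (hprime t ht).pos
    · rw [hu]
      unfold coeffA coeffB
      push_cast
      rcases mem_selmerPrimes.mp ht with ⟨i, hi, rfl⟩ | ⟨h2, rfl⟩
      · exact torsorSolvable_D hp hp2 hq hq2 hm hpq hD hinj hD2 hDp hDq hi l
      · exact torsorSolvable_two hp hp2 hq hpq hD hD2 h2 l
  obtain ⟨e⟩ := nonempty_spanSq_addEquiv _ hprime
  rw [hcard] at e
  let e' := ((spanSq (selmerPrimes p q D m)).equivMapOfInjective _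
    (kummer_injective (coeffA p q D) (coeffB_ne_zero hp hq hD))).symm.trans e
  refine ⟨⟨selmerPrimes p q D m, ?_, hcard, ⟨e⟩, hle, ⟨e'⟩⟩, ?_⟩
  · intro t ht
    rcases mem_selmerPrimes.mp ht with ⟨i, -, rfl⟩ | ⟨-, rfl⟩
    exacts [Or.inr ⟨i, rfl⟩, Or.inl rfl]
  -- The rank is a cardinal, so the lower bound needs no finiteness of the Selmer group.
  · exact cardinal_le_rank_of_addEquiv
      ((AddSubgroup.inclusion hle).comp e'.symm.toAddMonoidHom)
      ((AddSubgroup.inclusion_injective hle).comp e'.symm.injective)
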